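/- Assume the Continuum Hypothesis. For an uncountable regular cardinal $\theta$, $H(\theta)$ is the collection of all sets whose transitive closure has cardinality less than $\theta$; $H(\omega_1)=H(\aleph_1)$. Ordinals are von Neumann ordinals, $\lim(s)$ is the set of (nonzero, countable) limit points of $s\subseteq\omega_1$, and a *ladder* in $\delta$ is a cofinal subset of $\delta$ of order type $\omega$. **Parameters.** Let $\operatorname{ind}:H(\omega_1)\to\omega_1$ be a bijection with $\sup(x)<\operatorname{ind}(x)$ for every countable $x\subseteq\omega_1$; write $\operatorname{ind}(x,y)$ for $\operatorname{ind}((x,y))$. Let $\xi\mapsto\xi^*$ be a map from the countable limit ordinals to $\omega_1$ all of whose fibres $\{\xi:\xi^*=\varrho\}$ $(\varrho<\omega_1)$ are uncountable. Let $E\subseteq\omega_1$ be club. Put $C_{\alpha+1}=\{\alpha\}$ and, for a countable limit ordinal $\delta$, let $C_\delta$ be the ladder in $\delta$ of least index. For $\alpha\le\beta<\omega_1$ let $\varrho_1(\beta,\beta)=0$ and $\varrho_1(\alpha,\beta)=\max\bigl(|C_\beta\cap\alpha|,\ \varrho_1(\alpha,\min(C_\beta\setminus\alpha))\bigr)$ if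 $\alpha<\beta$; for $\alpha<\beta$ let $$e_\beta(\alpha)=2^{\varrho_1(\alpha,\beta)}\bigl(2\cdot|\{\xi\le\alpha:\varrho_1(\xi,\beta)=\varrho_1(\alpha,\beta)\}|+1\bigr).$$ **The tree $T=T_E$** consists of all countable closed sets $t$ of limit points of $E$ such that * if $\nu\in\lim(t)$, then $t\cap\nu$ has finite intersection with every ladder in $\nu$ that has index less than $\operatorname{ind}(E\cap\nu)$ or is $C_\nu$; * if $\nu\in\lim(t)$, then $\min(E\setminus\nu)<\operatorname{ind}(t\cap\nu)$; * for all $\alpha<\beta$, $\operatorname{ind}(t\cap[\alpha,\beta])<\min(t\setminus(\beta+1))$ whenever $t\setminus(\beta+1)\neq\emptyset$. $T$ is ordered by: $s\le t$ iff $s$ is an initial part of $t$. **The subtree $\tilde T=\tilde T_E\subseteq T$** is defined by recursion on $\delta=\sup(t)$. First, $\emptyset\in\tilde T$. Let $\delta>0$ and suppose that membership in $\tilde T$ is defined for sets with supremum less than $\delta$. Write $\tilde T\restriction\nu=\{t\in\tilde T:\operatorname{ind}(t)<\nu\}$. For $\beta<\delta$, $x,y,z$ ranging over nonempty closed subsets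 of $\beta$, and $t,s$ ranging over elements of $\tilde T$ included in $\beta$, define the following by recursion on $e_\delta(\min x)$: * $\theta_0^\delta(x,t,\beta)$: every element of $t$ is less than $\min(x)$, $t\cup x\in\tilde T\restriction\beta$, and $\operatorname{otp}(E\cap\min(x))^*=\operatorname{ind}(t,n)$ for some $n\in\omega$; * $\theta_1^\delta(x,t,\beta)$: whenever $\nu<\beta$ is a limit ordinal, $D$ is a dense subset of $\tilde T\restriction\nu$, $\operatorname{ind}(D)<\beta$ and $\operatorname{otp}(E\cap\min(x))^*=\operatorname{ind}(t,e_\delta(\operatorname{ind}(D)))$, then $t\cup x\in D$; * $\theta_2^\delta(x,t,\beta)$: for all $s$ and $y$, if $e_\delta(\min y)<e_\delta(\min x)$ and $\theta_i^\delta(y,s,\beta)$ for all $i<4$, then $x\cap y\subseteq\{\min x\}$; * $\theta_3^\delta(x,t,\beta)$: for all $s$ and $z$, if $\min z=\min x$ and $\theta_i^\delta(z,s,\beta)$ for all $i<3$, then $\operatorname{ind}(x)\le\operatorname{ind}(z)$. Let $t\in T$ with $\sup(t)=\delta$. If $\delta\notin\lim(t)$, then $t\in\tilde T$ iff $t\cap\delta\in\tilde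 T$. If $\delta\in\lim(t)$, then $t\in\tilde T$ iff $t\cap(\alpha+1)\in\tilde T$ for all $\alpha<\delta$ and, for all but finitely many pairs $\alpha<\beta$ of consecutive elements of $C_\delta$ with $(\alpha,\beta]\cap t\neq\emptyset$, the set $t\cap(\alpha,\beta]$ is included in $\beta$ and $\theta_i^\delta(t\cap(\alpha,\beta],\,t\cap(\alpha+1),\,\beta)$ holds for all $i<4$. **Lemma.** Let $M$ be a countable elementary submodel of $\bigl(H((2^{\omega_1})^+),\in\bigr)$ with $\tilde T\in M$. Suppose that $t_i$ $(i<n)$ is a finite sequence of elements of $\tilde T$ and that there is a club $C\subseteq\omega_1$ in $M$ with $C\cap M\subseteq\bigcup_{i<n}t_i$. Then $\tilde T$ has an uncountable chain. -/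

import Mathlib

universe u

open scoped Ordinal Cardinal

namespace SquareSpecialTree

/-! ### Coding sets of countable ordinals as sets, and the structures `H(θ)` -/

/-- The set (in the sense of `ZFSet`) whose elements are the von Neumann ordinals `α` with
`α ∈ s` and `α < ω₁`. -/
noncomputable def code (s : Set Ordinal.{u}) : ZFSet.{u} :=
  (ω₁ : Ordinal.{u}).toZFSet.sep fun z => ∃ α ∈ s, α.toZFSet = z

/-- The set (in the sense of `ZFSet`) whose elements are the codes of the members of `D`. -/
noncomputable def codeFam (D : Set (Set Ordinal.{u})) : ZFSet.{u} :=
  (ω₁ : Ordinal.{u}).toZFSet.powerset.sep fun z => ∃ t ∈ D, code t = z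

/-- `H(θ)`: the collection of all sets whose transitive closure has cardinality less than `θ`
(equivalently, which are included in some transitive set of cardinality less than `θ`). -/
def H (θ : Cardinal.{u}) : Set ZFSet.{u} :=
  {x | ∃ y : ZFSet.{u}, y.IsTransitive ∧ x ⊆ y ∧ y.card < θ}

/-- The relation symbols of the language of set theory: a single binary one. -/
inductive SetRel : ℕ → Type
  | mem : SetRel 2

/-- The first-order language of set theory. -/
def langSet : FirstOrder.Language :=
  ⟨fun _ => Empty, SetRel⟩

/-- A collection of sets as a structure for the language of set theory, with the true `∈`. -/
instance memStructure (A : Set ZFSet.{u}) : langSet.Structure A where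
  funMap f := nomatch f
  RelMap r := match r with
    | .mem => fun v => (v 0 : ZFSet.{u}) ∈ (v 1 : ZFSet.{u})

/-- `M` is a countable elementary submodel of `(H(θ), ∈)`. -/
def IsCountableElementarySubmodel (M : Set ZFSet.{u}) (θ : Cardinal.{u}) : Prop :=
  M.Countable ∧
    ∃ S : langSet.ElementarySubstructure (H θ), M = Subtype.val '' (S : Set (H θ))

/-! ### Sets of countable ordinals -/

/-- `E` is a closed unbounded subset of `ω₁`. -/
def IsClubOmega1 (E : Set Ordinal.{u}) : Prop :=
  E ⊆ Set.Iio ω₁ ∧ IsClub (Subtype.val ⁻¹' E : Set (Set.Iio (ω₁ : Ordinal.{u})))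

/-- `lim s`: the set of countable ordinals which are limit points of `s`. -/
def limPts (s : Set Ordinal.{u}) : Set Ordinal.{u} :=
  {δ | δ < ω₁ ∧ δ ≠ 0 ∧ ∀ γ < δ, ∃ α ∈ s, γ < α ∧ α < δ}

/-- The order type of a set of ordinals. -/
noncomputable def otp (s : Set Ordinal.{u}) : Ordinal.{u} :=
  sInf {o | Nonempty (Set.Iio o ≃o s)}

/-- `X` is a ladder in `δ`: a cofinal subset of `δ` of order type `ω`. -/
def IsLadder (δ : Ordinal.{u}) (X : Set Ordinal.{u}) : Prop :=
  X ⊆ Set.Iio δ ∧ (∀ γ < δ, ∃ α ∈ X, γ < α) ∧ Nonempty (ℕ ≃o X)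

/-- `s ≤ t`: the set `s` is an initial part of `t`. -/
def InitialPart (s t : Set Ordinal.{u}) : Prop :=
  s ⊆ t ∧ ∀ α ∈ t, ∀ β ∈ s, α ≤ β → α ∈ s

/-! ### The indexing function and the parameters derived from it -/

/-- `ind` restricts to a bijection `H(ω₁) → ω₁` such that `sup x < ind x` for every countable
subset `x` of `ω₁`. -/
def IsIndexing (ind : ZFSet.{u} → Ordinal.{u}) : Prop :=
  Set.BijOn ind (H ℵ₁) (Set.Iio ω₁) ∧
    ∀ s : Set Ordinal.{u}, s ⊆ Set.Iio ω₁ → s.Countable → sSup s < ind (code s)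

/-- `star` maps the countable limit ordinals into `ω₁`, and every countable ordinal is taken
as a value uncountably often. -/
def IsStar (star : Ordinal.{u} → Ordinal.{u}) : Prop :=
  (∀ ξ < ω₁, Order.IsSuccLimit ξ → star ξ < ω₁) ∧
    ∀ ρ < ω₁, ¬ {ξ | ξ < ω₁ ∧ Order.IsSuccLimit ξ ∧ star ξ = ρ}.Countable

/-- `X` is the ladder in `δ` of minimal index. -/
def IsMinLadder (ind : ZFSet.{u} → Ordinal.{u}) (δ : Ordinal.{u}) (X : Set Ordinal.{u}) : Prop :=
  IsLadder δ X ∧ ∀ Y, IsLadder δ Y → ind (code X) ≤ ind (code Y)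

/-- The `C`-sequence: `C_{α+1} = {α}`, and for a countable limit `δ`, `C_δ` is the ladder in `δ`
of minimal index. -/
def Cseq (ind : ZFSet.{u} → Ordinal.{u}) (δ : Ordinal.{u}) : Set Ordinal.{u} :=
  {γ | δ = γ + 1 ∨ ∃ X, IsMinLadder ind δ X ∧ γ ∈ X}

open Classical in
/-- The maximal weight `ϱ₁(α, β)` of the walk from `β` to `α` along the sequence `C`:
`ϱ₁(α, α) = 0` and `ϱ₁(α, β) = max (|C_β ∩ α|, ϱ₁(α, min (C_β \ α)))` for `α < β`. -/
noncomputable def rho1 (C : Ordinal.{u} → Set Ordinal.{u}) (α β : Ordinal.{u}) : ℕ :=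
  if _h : α < β ∧ sInf (C β \ Set.Iio α) < β then
    max (C β ∩ Set.Iio α).ncard (rho1 C α (sInf (C β \ Set.Iio α)))
  else 0
termination_by β
decreasing_by exact _h.2

/-- `ϱ̄₁(α, β) = 2 ^ ϱ₁(α, β) * (2 * |{ξ ≤ α : ϱ₁(ξ, β) = ϱ₁(α, β)}| + 1)`. -/
noncomputable def rhoBar1 (C : Ordinal.{u} → Set Ordinal.{u}) (α β : Ordinal.{u}) : ℕ :=
  2 ^ rho1 C α β * (2 * {ξ | ξ ≤ α ∧ rho1 C ξ β = rho1 C α β}.ncard + 1)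

/-- `e_β(α) = ϱ̄₁(α, β)`, computed from the `C`-sequence given by `ind`. -/
noncomputable def e (ind : ZFSet.{u} → Ordinal.{u}) (β α : Ordinal.{u}) : ℕ :=
  rhoBar1 (Cseq ind) α β

/-! ### The tree `T` -/

/-- The tree `T = T_E`. -/
def T (ind : ZFSet.{u} → Ordinal.{u}) (E : Set Ordinal.{u}) : Set (Set Ordinal.{u}) :=
  {t | t.Countable ∧ t ⊆ limPts E ∧ limPts t ⊆ t ∧
    (∀ ν ∈ limPts t, ∀ X, IsLadder ν X →
      (ind (code X) < ind (code (E ∩ Set.Iio ν)) ∨ X = Cseq ind ν) →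
        ((t ∩ Set.Iio ν) ∩ X).Finite) ∧
    (∀ ν ∈ limPts t, sInf (E \ Set.Iio ν) < ind (code (t ∩ Set.Iio ν))) ∧
    (∀ α β, α < β → ∀ γ ∈ t, β < γ → ind (code (t ∩ Set.Icc α β)) < γ)}

/-! ### The formulas `θ_i^δ(x, t, β)`

Here `S` is the set of those elements of the tree to be defined whose supremum is less than `δ`;
`star` is the map `ξ ↦ ξ^*`. -/

/-- The range of the variables `x`, `t` of the formulas for a given `β`: `x` is a nonempty
relatively closed subset of `β`, `t` is an element of the tree, and `t ⊆ β`. -/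
def Dom (S : Set (Set Ordinal.{u})) (x t : Set Ordinal.{u}) (β : Ordinal.{u}) : Prop :=
  x.Nonempty ∧ x ⊆ Set.Iio β ∧ limPts x ∩ Set.Iio β ⊆ x ∧ t ∈ S ∧ t ⊆ Set.Iio β

/-- The elements of `S` of index less than `ν`. -/
def restr (ind : ZFSet.{u} → Ordinal.{u}) (S : Set (Set Ordinal.{u})) (ν : Ordinal.{u}) :
    Set (Set Ordinal.{u}) :=
  {t | t ∈ S ∧ ind (code t) < ν}

/-- `D` is a dense subset of `P`, where `P` is ordered by end-extension. -/
def IsDenseIn (P D : Set (Set Ordinal.{u})) : Prop :=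
  D ⊆ P ∧ ∀ s ∈ P, ∃ d ∈ D, InitialPart s d

/-- `otp(E ∩ min x)^*`. -/
noncomputable def starMin (star : Ordinal.{u} → Ordinal.{u}) (E x : Set Ordinal.{u}) :
    Ordinal.{u} :=
  star (otp (E ∩ Set.Iio (sInf x)))

/-- `ind (t, n)`. -/
noncomputable def indPair (ind : ZFSet.{u} → Ordinal.{u}) (t : Set Ordinal.{u}) (n : ℕ) :
    Ordinal.{u} :=
  ind (ZFSet.pair (code t) (Ordinal.toZFSet (n : Ordinal.{u})))

/-- The formula `θ₀`. -/
def theta0 (ind : ZFSet.{u} → Ordinal.{u}) (star : Ordinal.{u} → Ordinal.{u})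
    (E : Set Ordinal.{u}) (S : Set (Set Ordinal.{u})) (x t : Set Ordinal.{u})
    (β : Ordinal.{u}) : Prop :=
  (∀ a ∈ t, ∀ b ∈ x, a < b) ∧ t ∪ x ∈ restr ind S β ∧ ∃ n : ℕ, starMin star E x = indPair ind t n

/-- The formula `θ₁`. -/
def theta1 (ind : ZFSet.{u} → Ordinal.{u}) (star : Ordinal.{u} → Ordinal.{u})
    (E : Set Ordinal.{u}) (S : Set (Set Ordinal.{u})) (δ : Ordinal.{u}) (x t : Set Ordinal.{u})
    (β : Ordinal.{u}) : Prop :=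
  ∀ (D : Set (Set Ordinal.{u})) (ν : Ordinal.{u}), Order.IsSuccLimit ν → ν < β →
    IsDenseIn (restr ind S ν) D → ind (codeFam D) < β →
    starMin star E x = indPair ind t (e ind δ (ind (codeFam D))) → t ∪ x ∈ D

/-- The conjunction `θ₀ ∧ θ₁ ∧ θ₂ ∧ θ₃`, by recursion on `e_δ(min x)`; see `theta2`, `theta3` and
`thetaAll_iff` below. -/
def thetaAll (ind : ZFSet.{u} → Ordinal.{u}) (star : Ordinal.{u} → Ordinal.{u})
    (E : Set Ordinal.{u}) (S : Set (Set Ordinal.{u})) (δ β : Ordinal.{u})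
    (x t : Set Ordinal.{u}) : Prop :=
  Dom S x t β ∧ theta0 ind star E S x t β ∧ theta1 ind star E S δ x t β ∧
  (∀ y s, (_hy : e ind δ (sInf y) < e ind δ (sInf x)) →
    thetaAll ind star E S δ β y s → x ∩ y ⊆ {sInf x}) ∧
  (∀ z s, (_hz : sInf z = sInf x) → Dom S z s β → theta0 ind star E S z s β →
    theta1 ind star E S δ z s β →
    (∀ y r, (_hy : e ind δ (sInf y) < e ind δ (sInf z)) →
      thetaAll ind star E S δ β y r → z ∩ y ⊆ {sInf z}) →
    ind (code x) ≤ ind (code z))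
termination_by e ind δ (sInf x)
decreasing_by
  · exact _hy
  · rw [← _hz]; exact _hy

/-- The formula `θ₂`. -/
def theta2 (ind : ZFSet.{u} → Ordinal.{u}) (star : Ordinal.{u} → Ordinal.{u})
    (E : Set Ordinal.{u}) (S : Set (Set Ordinal.{u})) (δ : Ordinal.{u}) (x : Set Ordinal.{u})
    (β : Ordinal.{u}) : Prop :=
  ∀ y s, e ind δ (sInf y) < e ind δ (sInf x) → thetaAll ind star E S δ β y s → x ∩ y ⊆ {sInf x}

/-- The formula `θ₃`. -/
def theta3 (ind : ZFSet.{u} → Ordinal.{u}) (star : Ordinal.{u} → Ordinal.{u})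
    (E : Set Ordinal.{u}) (S : Set (Set Ordinal.{u})) (δ : Ordinal.{u}) (x : Set Ordinal.{u})
    (β : Ordinal.{u}) : Prop :=
  ∀ z s, sInf z = sInf x → Dom S z s β → theta0 ind star E S z s β →
    theta1 ind star E S δ z s β → theta2 ind star E S δ z β → ind (code x) ≤ ind (code z)

/-- `thetaAll` is the conjunction of the four formulas. -/
theorem thetaAll_iff (ind : ZFSet.{u} → Ordinal.{u}) (star : Ordinal.{u} → Ordinal.{u})
    (E : Set Ordinal.{u}) (S : Set (Set Ordinal.{u})) (δ β : Ordinal.{u})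
    (x t : Set Ordinal.{u}) :
    thetaAll ind star E S δ β x t ↔
      Dom S x t β ∧ theta0 ind star E S x t β ∧ theta1 ind star E S δ x t β ∧
        theta2 ind star E S δ x β ∧ theta3 ind star E S δ x β := by
  rw [thetaAll]
  rfl

/-! ### The subtree `T̃` -/

/-- The pairs `α < β` of consecutive elements of `C` for which `(α, β] ∩ t` is nonempty. -/
def consecPairs (C t : Set Ordinal.{u}) : Set (Ordinal.{u} × Ordinal.{u}) :=
  {p | p.1 ∈ C ∧ p.2 ∈ C ∧ p.1 < p.2 ∧ (∀ γ ∈ C, ¬ (p.1 < γ ∧ γ < p.2)) ∧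
    (t ∩ Set.Ioc p.1 p.2).Nonempty}

/-- The elements of `T̃` with supremum `δ`, by recursion on `δ`. -/
def tildeLevel (ind : ZFSet.{u} → Ordinal.{u}) (star : Ordinal.{u} → Ordinal.{u})
    (E : Set Ordinal.{u}) (δ : Ordinal.{u}) : Set (Set Ordinal.{u}) :=
  let S : Set (Set Ordinal.{u}) := {s | ∃ ξ, ∃ _hξ : ξ < δ, s ∈ tildeLevel ind star E ξ}
  {t | t ∈ T ind E ∧ sSup t = δ ∧
    (t = ∅ ∨
      (δ ∉ limPts t ∧ t ∩ Set.Iio δ ∈ S) ∨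
      (δ ∈ limPts t ∧ (∀ α < δ, t ∩ Set.Iic α ∈ S) ∧
        {p ∈ consecPairs (Cseq ind δ) t |
          ¬ thetaAll ind star E S δ p.2 (t ∩ Set.Ioc p.1 p.2) (t ∩ Set.Iic p.1)}.Finite))}
termination_by δ
decreasing_by exact _hξ

/-- The tree `T̃ = T̃_E`. -/
def Ttilde (ind : ZFSet.{u} → Ordinal.{u}) (star : Ordinal.{u} → Ordinal.{u})
    (E : Set Ordinal.{u}) : Set (Set Ordinal.{u}) :=
  {t | ∃ δ, t ∈ tildeLevel ind star E δ}

end SquareSpecialTree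

namespace SquareSpecialTree

/-! Elementarity turns the hypothesis into one about all of `ω₁`. If some `C ∩ δ` were not covered
by `n` elements of the tree, such a `δ` could be found in `M`. The countable ordinals in `M` form an
initial segment (`toZFSet_mem_of_lt`), so `C ∩ δ` would lie in `M` and be covered by the given `t i`
after all (`coveredBy_of_submodel`).

The tree enters through one property, `Ttilde_almost_disjoint`: if `δ` is a limit point of two
elements that differ below `δ`, then their intersection has no limit points in some final segment of
`δ`. Indeed, on almost all intervals of the ladder `C_δ` the two pieces satisfy `θ₀` and `θ₂` over
different initial parts. By `θ₀` their minima differ, and then `θ₂` leaves at most one common point.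

The rest is finite combinatorics (`exists_uncountable_chain`). Let `k + 1` be the least number of
elements that suffices for some unbounded `C`. For unboundedly many `δ`, no final piece of `lim C ∩
δ` is covered by `k` elements. Hence every member of a cover of `C ∩ δ` is indispensable cofinally
below `δ`, and cofinally below each smaller `δ'` of this kind. Almost disjointness then makes the
covers for `δ'` and `δ` have the same `k + 1` traces on `δ'`. These traces never split or die out,
so following one of them gives an uncountable chain. -/

/-! ### Limit points and unbounded subsets of `ω₁` -/

theorem limPts_mono {s t : Set Ordinal.{u}} (h : s ⊆ t) : limPts s ⊆ limPts t := by
  rintro δ ⟨h1, h2, h3⟩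
  refine ⟨h1, h2, fun γ hγ => ?_⟩
  obtain ⟨α, hα, h'⟩ := h3 γ hγ
  exact ⟨α, h hα, h'⟩

/-- If a finite family covers `C` on a final segment of `c ∈ lim C`, then `c` is a limit point of
the intersection of `C` with a member of the family. -/
theorem exists_mem_limPts_inter {C : Set Ordinal.{u}} {F : Finset (Set Ordinal.{u})}
    {γ c : Ordinal.{u}} (hγ : γ < c) (hc : c ∈ limPts C)
    (hF : ∀ x ∈ C, γ < x → x < c → ∃ t ∈ F, x ∈ t) : ∃ t ∈ F, c ∈ limPts (C ∩ t) := by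
  by_contra! h
  have h' : ∀ t ∈ F, ∃ γ' < c, ∀ x ∈ C ∩ t, γ' < x → c ≤ x := by
    intro t ht
    by_contra! h2
    exact h t ht ⟨hc.1, hc.2.1, h2⟩
  choose! g hg hg' using h'
  -- Finitely many bounds below `c` have a maximum below `c`; a point of `C` beyond it lies in no
  -- member of the family.
  obtain ⟨x, hx, hx1, hx2⟩ := hc.2.2 (F.sup g ⊔ γ) (by
    rw [max_lt_iff]
    refine ⟨(Finset.sup_lt_iff (bot_le.trans_lt hγ)).2 hg, hγ⟩)
  obtain ⟨t, ht, hxt⟩ := hF x hx (le_sup_right.trans_lt hx1) hx2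
  exact absurd (hg' t ht x ⟨hx, hxt⟩ (((Finset.le_sup ht).trans le_sup_left).trans_lt hx1))
    (not_le.2 hx2)

/-- `C` is an unbounded subset of `ω₁`. -/
def IsUnbounded (C : Set Ordinal.{u}) : Prop :=
  C ⊆ Set.Iio ω₁ ∧ ∀ γ < ω₁, ∃ α ∈ C, γ < α

theorem iSup_nat_lt_omega_one {f : ℕ → Ordinal.{u}} (hf : ∀ n, f n < ω₁) : ⨆ n, f n < ω₁ :=
  Ordinal.iSup_lt_omega_one hf

theorem add_one_lt_omega_one {γ : Ordinal.{u}} (h : γ < ω₁) : γ + 1 < ω₁ :=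
  (Cardinal.isSuccLimit_omega 1).add_one_lt h

/-- Above any countable ordinal there is a countable limit of iterates of a given map. -/
theorem exists_limit_of_iterates {f : Ordinal.{u} → Ordinal.{u}} (hf : ∀ γ < ω₁, f γ < ω₁)
    (hf' : ∀ γ < ω₁, γ < f γ) {ε : Ordinal.{u}} (hε : ε < ω₁) :
    ∃ δ < ω₁, ε < δ ∧ ∀ γ < δ, ∃ ξ, γ < ξ ∧ ξ < f ξ ∧ f ξ < δ := by
  have hlt : ∀ n : ℕ, f^[n] ε < ω₁ := by
    intro n
    induction n with
    | zero => exact hε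
    | succ n ih => rw [Function.iterate_succ_apply']; exact hf _ ih
  have hs : ∀ n : ℕ, f^[n] ε < f^[n + 1] ε := fun n => by
    rw [Function.iterate_succ_apply']; exact hf' _ (hlt n)
  have hle : ∀ n : ℕ, f^[n] ε < ⨆ n, f^[n] ε := fun n =>
    (hs n).trans_le (Ordinal.le_iSup (fun n => f^[n] ε) (n + 1))
  refine ⟨⨆ n, f^[n] ε, iSup_nat_lt_omega_one hlt, hle 0, fun γ hγ => ?_⟩
  obtain ⟨n, hn⟩ := (Ordinal.lt_iSup_iff).1 hγ
  refine ⟨f^[n] ε, hn, hf' _ (hlt n), ?_⟩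
  rw [← Function.iterate_succ_apply' f]
  exact hle (n + 1)

theorem IsUnbounded.limPts {C : Set Ordinal.{u}} (hC : IsUnbounded C) :
    IsUnbounded (limPts C) := by
  refine ⟨fun δ h => h.1, fun ε hε => ?_⟩
  choose! f hf hf' using hC.2
  obtain ⟨δ, h1, h2, h3⟩ := exists_limit_of_iterates (f := f) (fun γ h => hC.1 (hf γ h)) hf' hε
  refine ⟨δ, ⟨h1, (bot_le.trans_lt h2).ne', fun γ hγ => ?_⟩, h2⟩
  obtain ⟨ξ, a, b, c⟩ := h3 γ hγ
  exact ⟨f ξ, hf ξ ((b.trans c).trans h1), a.trans b, c⟩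

theorem IsUnbounded.not_countable {C : Set Ordinal.{u}} (hC : IsUnbounded C) :
    ¬ C.Countable := by
  intro h
  have : Countable C := h.to_subtype
  have h2 : ⨆ x : C, (x : Ordinal.{u}) < ω₁ := Ordinal.iSup_lt_omega_one fun x => hC.1 x.2
  obtain ⟨α, hα, h3⟩ := hC.2 _ h2
  exact absurd (Ordinal.le_iSup (fun x : C => (x : Ordinal.{u})) ⟨α, hα⟩) (not_le.2 h3)

/-! ### Minimal finite covers and the chain they produce -/

/-- `X` is covered by at most `n` members of `P`. -/
def CoveredBy (P : Set (Set Ordinal.{u})) (n : ℕ) (X : Set Ordinal.{u}) : Prop :=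
  ∃ F : Finset (Set Ordinal.{u}), ↑F ⊆ P ∧ F.card ≤ n ∧ ∀ x ∈ X, ∃ t ∈ F, x ∈ t

theorem CoveredBy.mono {P : Set (Set Ordinal.{u})} {n : ℕ} {X Y : Set Ordinal.{u}}
    (h : CoveredBy P n Y) (hXY : X ⊆ Y) : CoveredBy P n X := by
  obtain ⟨F, h1, h2, h3⟩ := h
  exact ⟨F, h1, h2, fun x hx => h3 x (hXY hx)⟩

/-- If, for some unbounded `C ⊆ ω₁` and some `n`, all sets `C ∩ δ` are covered by `n` members of
`P`, then there are such `C` and `n = k + 1` for which moreover the sets `δ` with the property that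
no `lim C ∩ (γ, δ)` is covered by `k` members of `P` are unbounded. -/
theorem exists_minimal_cover {P : Set (Set Ordinal.{u})} {n : ℕ} {C : Set Ordinal.{u}}
    (hC : IsUnbounded C) (h : ∀ δ < ω₁, CoveredBy P n (C ∩ Set.Iio δ)) :
    ∃ k, ∃ C : Set Ordinal.{u}, IsUnbounded C ∧
      (∀ δ < ω₁, CoveredBy P (k + 1) (C ∩ Set.Iio δ)) ∧
      IsUnbounded {δ | δ < ω₁ ∧ (∀ γ < δ, ¬ CoveredBy P k (limPts C ∩ Set.Ioo γ δ)) ∧ 0 < δ} := by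
  classical
  -- The minimum is taken over all unbounded sets at once, so that it also bounds the covers of
  -- final segments of `lim C'`.
  let Q : ℕ → Prop := fun n => ∃ C : Set Ordinal.{u}, IsUnbounded C ∧
    ∀ δ < ω₁, CoveredBy P n (C ∩ Set.Iio δ)
  have hQ : ∃ n, Q n := ⟨n, C, hC, h⟩
  obtain ⟨C', hC', h'⟩ := Nat.find_spec hQ
  have h0 : Nat.find hQ ≠ 0 := by
    intro h0
    rw [h0] at h'
    obtain ⟨α, hα, -⟩ := hC'.2 0 (Ordinal.omega_pos 1)
    obtain ⟨F, -, h2, h3⟩ := h' (α + 1) (add_one_lt_omega_one (hC'.1 hα))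
    obtain ⟨t, ht, -⟩ := h3 α ⟨hα, lt_add_one α⟩
    rw [Finset.card_eq_zero.1 (Nat.le_zero.1 h2)] at ht
    simp at ht
  obtain ⟨k, hk⟩ := Nat.exists_eq_succ_of_ne_zero h0
  rw [hk] at h'
  have hkQ : ¬ Q k := Nat.find_min hQ (by omega)
  refine ⟨k, C', hC', h', fun δ h => h.1, fun ε hε => ?_⟩
  have key : ∀ γ < ω₁, ∃ δ, γ < δ ∧ δ < ω₁ ∧ ¬ CoveredBy P k (limPts C' ∩ Set.Ioo γ δ) := by
    intro γ hγ
    by_contra! hcon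
    -- Otherwise the final segment of `lim C'` above `γ` would be an unbounded set needing only `k`
    -- members.
    refine hkQ ⟨limPts C' ∩ Set.Ioi γ, ⟨fun x hx => hx.1.1, fun η hη => ?_⟩, fun δ hδ => ?_⟩
    · obtain ⟨α, h1, h2⟩ := hC'.limPts.2 (max η γ) (max_lt hη hγ)
      rw [max_lt_iff] at h2
      exact ⟨α, ⟨h1, h2.2⟩, h2.1⟩
    · rcases le_or_gt δ γ with hle | hlt
      · refine ⟨∅, by simp, by simp, fun x hx => ?_⟩
        exact absurd (hx.1.2.trans hx.2) (not_lt.2 hle)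
      · refine (hcon δ hlt hδ).mono ?_
        rintro x ⟨⟨h1, h2⟩, h3⟩
        exact ⟨h1, h2, h3⟩
  choose! f hf1 hf2 hf3 using key
  -- A limit of iterates of `f` contains an uncovered interval `(ξ, f ξ)` above each `γ < δ`.
  obtain ⟨δ, h1, h2, h3⟩ := exists_limit_of_iterates (f := f) hf2 hf1 hε
  refine ⟨δ, ⟨h1, fun γ hγ hcov => ?_, bot_le.trans_lt h2⟩, h2⟩
  obtain ⟨ξ, a, b, c⟩ := h3 γ hγ
  refine hf3 ξ ((b.trans c).trans h1) (hcov.mono ?_)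
  rintro x ⟨hx, hx1, hx2⟩
  exact ⟨hx, a.trans hx1, hx2.trans c⟩

/-- Suppose that members of `P` are closed, that any two members of `P` with the limit point `δ`
which differ below `δ` have an intersection without limit points in a final segment of `δ`, and
that the truncations of members of `P` at their limit points are in `P`. If, for some unbounded
`C ⊆ ω₁`, the sets `C ∩ δ` are all covered by `n` members of `P`, then `P` has an uncountable
chain. -/
theorem exists_uncountable_chain {P : Set (Set Ordinal.{u})}
    (hclosed : ∀ t ∈ P, limPts t ⊆ t)
    (hdisj : ∀ s ∈ P, ∀ t ∈ P, ∀ δ ∈ limPts s, δ ∈ limPts t →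
      s ∩ Set.Iio δ ≠ t ∩ Set.Iio δ → ∃ γ < δ, ∀ ν ∈ limPts (s ∩ t), γ < ν → ¬ ν < δ)
    (hseg : ∀ t ∈ P, ∀ δ ∈ limPts t, t ∩ Set.Iic δ ∈ P)
    {n : ℕ} {C : Set Ordinal.{u}} (hC : IsUnbounded C)
    (h : ∀ δ < ω₁, CoveredBy P n (C ∩ Set.Iio δ)) :
    ∃ b ⊆ P, IsChain InitialPart b ∧ ¬ b.Countable := by
  classical
  obtain ⟨k, C, hC, hcov, hG⟩ := exists_minimal_cover hC h
  set G := {δ | δ < ω₁ ∧ (∀ γ < δ, ¬ CoveredBy P k (limPts C ∩ Set.Ioo γ δ)) ∧ 0 < δ} with hGdef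
  choose! F hFP hFcard hFcov using hcov
  have hGpos : ∀ δ ∈ G, 0 < δ := fun δ h => h.2.2
  -- Without `t` at most `k` members remain, too few for a final piece of `lim C ∩ δ'`; so cofinally
  -- many points of `lim C` are approached by `C ∩ s` for no `s` other than `t`.
  have hneed : ∀ δ' ∈ G, ∀ δ ∈ G, δ' ≤ δ → ∀ t ∈ F δ, ∀ γ < δ', ∃ c ∈ limPts C, γ < c ∧ c < δ' ∧
      ∀ s ∈ F δ, c ∈ limPts (C ∩ s) → s = t := by
    intro δ' hδ' δ hδ hle t ht γ hγ
    by_contra! hcon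
    refine hδ'.2.1 γ hγ ⟨(F δ).erase t, ?_, ?_, ?_⟩
    · exact fun s hs => hFP δ hδ.1 (Finset.mem_of_mem_erase hs)
    · rw [Finset.card_erase_of_mem ht]
      have := hFcard δ hδ.1
      omega
    · rintro c ⟨hc, hc1, hc2⟩
      obtain ⟨s, hs, h1, h2⟩ := hcon c hc hc1 hc2
      exact ⟨s, Finset.mem_erase.2 ⟨h2, hs⟩,
        hclosed s (hFP δ hδ.1 hs) (limPts_mono Set.inter_subset_right h1)⟩
  have hfind : ∀ δ' ∈ G, ∀ δ ∈ G, δ' ≤ δ → ∀ t ∈ F δ, ∀ γ < δ', ∃ c, γ < c ∧ c < δ' ∧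
      c ∈ limPts C ∧ c ∈ limPts (C ∩ t) ∧ ∀ s ∈ F δ, c ∈ limPts (C ∩ s) → s = t := by
    intro δ' hδ' δ hδ hle t ht γ hγ
    obtain ⟨c, hc, h1, h2, h3⟩ := hneed δ' hδ' δ hδ hle t ht γ hγ
    obtain ⟨s, hs, hs'⟩ := exists_mem_limPts_inter (F := F δ) h1 hc fun x hx _ hx2 =>
      hFcov δ hδ.1 x ⟨hx, (hx2.trans h2).trans_le hle⟩
    have := h3 s hs hs'
    subst this
    exact ⟨c, h1, h2, hc, hs', h3⟩
  have hlim : ∀ δ' ∈ G, ∀ δ ∈ G, δ' ≤ δ → ∀ t ∈ F δ, δ' ∈ limPts t := by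
    intro δ' hδ' δ hδ hle t ht
    refine ⟨hδ'.1, (hGpos δ' hδ').ne', fun γ hγ => ?_⟩
    obtain ⟨c, h1, h2, -, h3, -⟩ := hfind δ' hδ' δ hδ hle t ht γ hγ
    exact ⟨c, hclosed t (hFP δ hδ.1 ht) (limPts_mono Set.inter_subset_right h3), h1, h2⟩
  -- Being a limit point of `C ∩ t` below `δ'` depends only on the trace of `t` on `δ'`, so a point
  -- private to `t` tells its trace from all others.
  have hinj : ∀ δ' ∈ G, ∀ δ ∈ G, δ' ≤ δ → ∀ t ∈ F δ, ∀ s ∈ F δ,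
      t ∩ Set.Iio δ' = s ∩ Set.Iio δ' → t = s := by
    intro δ' hδ' δ hδ hle t ht s hs hts
    obtain ⟨c, h1, h2, -, h3, h4⟩ := hfind δ' hδ' δ hδ hle t ht 0 (hGpos δ' hδ')
    refine (h4 s hs ⟨h3.1, h3.2.1, fun γ hγ => ?_⟩).symm
    obtain ⟨x, hx, hx1, hx2⟩ := h3.2.2 γ hγ
    have : x ∈ s ∩ Set.Iio δ' := hts ▸ ⟨hx.2, hx2.trans h2⟩
    exact ⟨x, ⟨hx.1, this.1⟩, hx1, hx2⟩
  have hcard : ∀ δ ∈ G, (F δ).card = k + 1 := by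
    intro δ hδ
    refine (hFcard δ hδ.1).antisymm (Nat.succ_le_iff.2 (not_le.1 fun hle => ?_))
    refine hδ.2.1 0 (hGpos δ hδ) ⟨F δ, hFP δ hδ.1, hle, ?_⟩
    rintro c ⟨hc, hc1, hc2⟩
    obtain ⟨s, hs, hs'⟩ := exists_mem_limPts_inter (F := F δ) hc1 hc fun x hx _ hx2 =>
      hFcov δ hδ.1 x ⟨hx, hx2.trans hc2⟩
    exact ⟨s, hs, hclosed s (hFP δ hδ.1 hs) (limPts_mono Set.inter_subset_right hs')⟩
  have hext : ∀ δ' ∈ G, ∀ δ ∈ G, δ' ≤ δ → ∀ t ∈ F δ', ∃ s ∈ F δ,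
      s ∩ Set.Iio δ' = t ∩ Set.Iio δ' := by
    intro δ' hδ' δ hδ hle t ht
    by_contra! hcon
    have : ∀ s ∈ F δ, ∃ γ < δ', ∀ ν ∈ limPts (s ∩ t), γ < ν → ¬ ν < δ' := fun s hs =>
      hdisj s (hFP δ hδ.1 hs) t (hFP δ' hδ'.1 ht) δ' (hlim δ' hδ' δ hδ hle s hs)
        (hlim δ' hδ' δ' hδ' le_rfl t ht) (hcon s hs)
    choose! g hg hg' using this
    -- Past all the bounds there is still a limit point `c` of `C ∩ t`. Since `F δ` covers `C` below
    -- `c`, some `s ∈ F δ` has `c` as a limit point of `s ∩ t`.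
    obtain ⟨c, h1, h2, -, h3, -⟩ := hfind δ' hδ' δ' hδ' le_rfl t ht ((F δ).sup g)
      ((Finset.sup_lt_iff (hGpos δ' hδ')).2 hg)
    obtain ⟨s, hs, hs'⟩ := exists_mem_limPts_inter (F := F δ) h1 h3 fun x hx _ hx2 =>
      hFcov δ hδ.1 x ⟨hx.1, (hx2.trans h2).trans_le hle⟩
    exact hg' s hs c (limPts_mono (s := (C ∩ t) ∩ s) (t := s ∩ t) (fun x hx => ⟨hx.2, hx.1.2⟩) hs')
      ((Finset.le_sup hs).trans_lt h1) h2
  -- One set of traces includes the other, and both have `k + 1` elements.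
  have himage : ∀ δ' ∈ G, ∀ δ ∈ G, δ' ≤ δ →
      (F δ').image (· ∩ Set.Iio δ') = (F δ).image (· ∩ Set.Iio δ') := by
    intro δ' hδ' δ hδ hle
    refine Finset.eq_of_subset_of_card_le ?_ ?_
    · intro u hu
      obtain ⟨t, ht, rfl⟩ := Finset.mem_image.1 hu
      obtain ⟨s, hs, h⟩ := hext δ' hδ' δ hδ hle t ht
      exact Finset.mem_image.2 ⟨s, hs, h⟩
    · rw [Finset.card_image_of_injOn fun t ht s hs h => hinj δ' hδ' δ hδ hle t ht s hs h,
        Finset.card_image_of_injOn fun t ht s hs h => hinj δ' hδ' δ' hδ' le_rfl t ht s hs h,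
        hcard δ hδ, hcard δ' hδ']
  obtain ⟨δ₀, hδ₀, -⟩ := hG.2 0 (Ordinal.omega_pos 1)
  obtain ⟨t₀, ht₀⟩ : (F δ₀).Nonempty := by
    rw [← Finset.card_pos, hcard δ₀ hδ₀]; omega
  have hle_init : ∀ δ' ∈ G, ∀ δ ∈ G, δ₀ ≤ δ' → δ' ≤ δ → ∀ s ∈ F δ', ∀ t ∈ F δ,
      s ∩ Set.Iio δ₀ = t₀ ∩ Set.Iio δ₀ → t ∩ Set.Iio δ₀ = t₀ ∩ Set.Iio δ₀ →
      InitialPart (s ∩ Set.Iic δ') (t ∩ Set.Iic δ) := by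
    intro δ' hδ' δ hδ h0 hle s hs t ht hs0 ht0
    obtain ⟨s', hs', hs't⟩ : ∃ s' ∈ F δ', s' ∩ Set.Iio δ' = t ∩ Set.Iio δ' := by
      have := himage δ' hδ' δ hδ hle ▸ Finset.mem_image_of_mem (· ∩ Set.Iio δ') ht
      exact Finset.mem_image.1 this
    have hss' : s' = s := by
      refine hinj δ₀ hδ₀ δ' hδ' h0 s' hs' s hs ?_
      rw [hs0, ← ht0]
      ext x
      have := Set.ext_iff.1 hs't x
      simp only [Set.mem_inter_iff, Set.mem_Iio] at this ⊢
      constructor <;> rintro ⟨h1, h2⟩ <;> have := this.1 <;> grind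
    subst hss'
    have hmem : ∀ x < δ', x ∈ s' ↔ x ∈ t := fun x hx => by
      have := Set.ext_iff.1 hs't x
      simpa [hx] using this
    have hδs : δ' ∈ s' := hclosed s' (hFP δ' hδ'.1 hs) (hlim δ' hδ' δ' hδ' le_rfl s' hs)
    have hδt : δ' ∈ t := hclosed t (hFP δ hδ.1 ht) (hlim δ' hδ' δ hδ hle t ht)
    refine ⟨?_, ?_⟩
    · rintro x ⟨hx, hx'⟩
      refine ⟨?_, le_trans hx' hle⟩
      rcases (Set.mem_Iic.1 hx').lt_or_eq with h | h
      · exact (hmem x h).1 hx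
      · rwa [h]
    · rintro x ⟨hx, -⟩ y ⟨-, hy⟩ hxy
      have hxδ : x ≤ δ' := hxy.trans hy
      refine ⟨?_, hxδ⟩
      rcases hxδ.lt_or_eq with h | h
      · exact (hmem x h).2 hx
      · rwa [h]
  -- The chain follows the trace of `t₀`. Truncation at `Iic δ` keeps the limit point `δ`, so that
  -- `hseg` applies and the supremum recovers `δ`.
  refine ⟨{u | ∃ δ ∈ G, δ₀ ≤ δ ∧ ∃ t ∈ F δ, t ∩ Set.Iio δ₀ = t₀ ∩ Set.Iio δ₀ ∧
    u = t ∩ Set.Iic δ}, ?_, ?_, ?_⟩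
  · rintro u ⟨δ, hδ, -, t, ht, -, rfl⟩
    exact hseg t (hFP δ hδ.1 ht) δ (hlim δ hδ δ hδ le_rfl t ht)
  · rintro u ⟨δ, hδ, hδ0, t, ht, ht0, rfl⟩ v ⟨δ', hδ', hδ0', t', ht', ht0', rfl⟩ -
    rcases le_total δ δ' with hle | hle
    · exact Or.inl (hle_init δ hδ δ' hδ' hδ0 hle t ht t' ht' ht0 ht0')
    · exact Or.inr (hle_init δ' hδ' δ hδ hδ0' hle t' ht' t ht ht0' ht0)
  · intro hcount
    refine IsUnbounded.not_countable (C := G ∩ Set.Ici δ₀) ⟨fun x hx => hx.1.1, fun γ hγ => ?_⟩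
      ((hcount.image sSup).mono ?_)
    · obtain ⟨α, h1, h2⟩ := hG.2 (max γ δ₀) (max_lt hγ hδ₀.1)
      rw [max_lt_iff] at h2
      exact ⟨α, ⟨h1, h2.2.le⟩, h2.1⟩
    · rintro δ ⟨hδ, hδ0⟩
      obtain ⟨t, ht, htt⟩ := hext δ₀ hδ₀ δ hδ hδ0 t₀ ht₀
      refine ⟨t ∩ Set.Iic δ, ⟨δ, hδ, hδ0, t, ht, htt, rfl⟩, ?_⟩
      refine IsGreatest.csSup_eq ⟨⟨?_, Set.self_mem_Iic⟩, fun x hx => hx.2⟩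
      exact hclosed t (hFP δ hδ.1 ht) (hlim δ hδ δ hδ le_rfl t ht)

/-! ### Codes -/

theorem mem_code {s : Set Ordinal.{u}} {z : ZFSet.{u}} :
    z ∈ code s ↔ ∃ α ∈ s, α < ω₁ ∧ α.toZFSet = z := by
  rw [code, ZFSet.mem_sep, Ordinal.mem_toZFSet_iff]
  constructor
  · rintro ⟨⟨a, ha, rfl⟩, α, hα, h⟩
    exact ⟨α, hα, Ordinal.toZFSet_injective h ▸ ha, h⟩
  · rintro ⟨α, hα, h, rfl⟩
    exact ⟨⟨α, h, rfl⟩, α, hα, rfl⟩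

theorem toZFSet_mem_code {s : Set Ordinal.{u}} {α : Ordinal.{u}} :
    α.toZFSet ∈ code s ↔ α ∈ s ∧ α < ω₁ := by
  rw [mem_code]
  constructor
  · rintro ⟨β, h1, h2, h3⟩
    rw [← Ordinal.toZFSet_injective h3]
    exact ⟨h1, h2⟩
  · rintro ⟨h1, h2⟩
    exact ⟨α, h1, h2, rfl⟩

theorem code_injOn : Set.InjOn code (Set.powerset (Set.Iio (ω₁ : Ordinal.{u}))) := by
  intro s hs t ht h
  ext α
  have : α.toZFSet ∈ code s ↔ α.toZFSet ∈ code t := by rw [h]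
  rw [toZFSet_mem_code, toZFSet_mem_code] at this
  constructor
  · intro hα
    exact (this.1 ⟨hα, hs hα⟩).1
  · intro hα
    exact (this.2 ⟨hα, ht hα⟩).1

theorem card_lt_aleph_one {δ : Ordinal.{u}} (h : δ < ω₁) : δ.card < ℵ₁ := by
  rw [← Cardinal.ord_aleph, Cardinal.lt_ord] at h
  exact h

theorem countable_Iio {δ : Ordinal.{u}} (h : δ < ω₁) : (Set.Iio δ).Countable := by
  rw [← Cardinal.le_aleph0_iff_set_countable, Cardinal.mk_Iio_ordinal,
    ← Cardinal.lift_aleph0.{u + 1, u}, Cardinal.lift_le, ← Cardinal.lt_aleph_one_iff]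
  exact card_lt_aleph_one h

theorem isTransitive_toZFSet (δ : Ordinal.{u}) : δ.toZFSet.IsTransitive :=
  (ZFSet.isOrdinal_toZFSet δ).isTransitive

theorem toZFSet_mem_H {δ : Ordinal.{u}} (h : δ < ω₁) : δ.toZFSet ∈ H (ℵ₁ : Cardinal.{u}) :=
  ⟨δ.toZFSet, isTransitive_toZFSet δ, fun _ h => h, by
    rw [Ordinal.card_toZFSet]; exact card_lt_aleph_one h⟩

theorem code_mem_H {s : Set Ordinal.{u}} {δ : Ordinal.{u}} (h : δ < ω₁) (hs : s ⊆ Set.Iio δ) :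
    code s ∈ H (ℵ₁ : Cardinal.{u}) := by
  refine ⟨δ.toZFSet, isTransitive_toZFSet δ, fun z hz => ?_, ?_⟩
  · obtain ⟨α, hα, -, rfl⟩ := mem_code.1 hz
    exact Ordinal.toZFSet_mem_toZFSet_iff.2 (hs hα)
  · rw [Ordinal.card_toZFSet]
    exact card_lt_aleph_one h

theorem H_mono {θ θ' : Cardinal.{u}} (h : θ ≤ θ') : H θ ⊆ H θ' := by
  rintro x ⟨y, h1, h2, h3⟩
  exact ⟨y, h1, h2, h3.trans_le h⟩

theorem mem_H_of_mem {θ : Cardinal.{u}} {x y : ZFSet.{u}} (hx : x ∈ H θ) (hy : y ∈ x) :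
    y ∈ H θ := by
  obtain ⟨z, h1, h2, h3⟩ := hx
  exact ⟨z, h1, h1 y (h2 hy), h3⟩

/-- Adjoining `x`, `y`, `{x}` and `{x, y}` to the union of two transitive witnesses keeps it
transitive and adds at most four elements. -/
theorem pair_mem_H {θ : Cardinal.{u}} (hθ : ℵ₀ ≤ θ) {x y : ZFSet.{u}} (hx : x ∈ H θ)
    (hy : y ∈ H θ) : ZFSet.pair x y ∈ H θ := by
  obtain ⟨a, ha, hxa, hac⟩ := hx
  obtain ⟨b, hb, hyb, hbc⟩ := hy
  have hins : ∀ z w : ZFSet.{u}, w.IsTransitive → z ⊆ w → w.card < θ →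
      (insert z w : ZFSet.{u}).IsTransitive ∧ (insert z w : ZFSet.{u}).card < θ := by
    intro z w hw hz hc
    refine ⟨fun v hv q hq => ?_, ZFSet.card_insert_le.trans_lt
      (Cardinal.add_lt_of_lt hθ hc (Cardinal.one_lt_aleph0.trans_le hθ))⟩
    rw [ZFSet.mem_insert_iff] at hv ⊢
    rcases hv with rfl | hv
    · exact Or.inr (hz hq)
    · exact Or.inr (hw v hv hq)
  have h0 : (a ∪ b).IsTransitive := ha.union hb
  have h0c : (a ∪ b).card < θ :=
    ZFSet.card_union_le.trans_lt (Cardinal.add_lt_of_lt hθ hac hbc)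
  obtain ⟨h1, h1c⟩ := hins x (a ∪ b) h0 (fun z hz => ZFSet.mem_union.2 (Or.inl (hxa hz))) h0c
  obtain ⟨h2, h2c⟩ := hins y _ h1 (fun z hz => ZFSet.mem_insert_iff.2 <| Or.inr <|
    ZFSet.mem_union.2 (Or.inr (hyb hz))) h1c
  obtain ⟨h3, h3c⟩ := hins {x} _ h2 (fun z hz => by
    rw [ZFSet.mem_singleton] at hz; subst hz; simp) h2c
  obtain ⟨h4, h4c⟩ := hins {x, y} _ h3 (fun z hz => by
    rw [ZFSet.mem_pair] at hz; rcases hz with rfl | rfl <;> simp) h3c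
  refine ⟨_, h4, fun z hz => ?_, h4c⟩
  rw [ZFSet.pair, ZFSet.mem_pair] at hz
  rcases hz with rfl | rfl <;> simp

/-- This is how `θ₀` makes the minimum of a piece determine the initial part below it. The bound `β`
puts the codes into `H ℵ₁`, where `ind` is injective. -/
theorem indPair_inj {ind : ZFSet.{u} → Ordinal.{u}} (hind : IsIndexing ind) {s t : Set Ordinal.{u}}
    {β : Ordinal.{u}} (hβ : β < ω₁) (hs : s ⊆ Set.Iio β) (ht : t ⊆ Set.Iio β) {m n : ℕ}
    (h : indPair ind s m = indPair ind t n) : s = t := by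
  have hω : ∀ n : ℕ, (Ordinal.toZFSet (n : Ordinal.{u})) ∈ H (ℵ₁ : Cardinal.{u}) := fun n =>
    toZFSet_mem_H ((Ordinal.natCast_lt_omega0 n).trans Ordinal.omega0_lt_omega_one)
  have hle : (ℵ₀ : Cardinal.{u}) ≤ ℵ₁ := Cardinal.aleph0_lt_aleph_one.le
  have := hind.1.injOn (pair_mem_H hle (code_mem_H hβ hs) (hω m))
    (pair_mem_H hle (code_mem_H hβ ht) (hω n)) h
  have hsub : Set.Iio β ⊆ Set.Iio ω₁ := Set.Iio_subset_Iio hβ.le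
  exact code_injOn (hs.trans hsub) (ht.trans hsub) (ZFSet.pair_inj.1 this).1

/-! ### Ladders and the `C`-sequence -/

theorem exists_isLadder {δ : Ordinal.{u}} (hδ : δ < ω₁) (hlim : Order.IsSuccLimit δ) :
    ∃ X, IsLadder δ X := by
  have h0 : (0 : Ordinal.{u}) < δ := hlim.bot_lt
  obtain ⟨g, hg⟩ := (countable_Iio hδ).exists_eq_range ⟨0, h0⟩
  have hgδ : ∀ n, g n < δ := fun n => by
    have : g n ∈ Set.Iio δ := hg ▸ Set.mem_range_self n
    exact this
  -- A strictly increasing sequence that overtakes each term of the enumeration `g` of `δ`.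
  let f : ℕ → Ordinal.{u} := fun n => n.rec 0 fun n a => max a (g n) + 1
  have hf : ∀ n, f (n + 1) = max (f n) (g n) + 1 := fun n => rfl
  have hmono : StrictMono f := strictMono_nat_of_lt_succ fun n => by
    rw [hf]
    exact (le_max_left _ _).trans_lt (lt_add_one _)
  refine ⟨Set.range f, ?_, fun γ hγ => ?_, ⟨hmono.orderIso⟩⟩
  · rintro _ ⟨n, rfl⟩
    induction n with
    | zero => exact h0
    | succ n ih =>
      rw [hf]
      exact hlim.add_one_lt (max_lt ih (hgδ n))
  · have : γ ∈ Set.range g := hg ▸ hγ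
    obtain ⟨n, rfl⟩ := this
    exact ⟨f (n + 1), ⟨n + 1, rfl⟩, (le_max_right _ _).trans_lt (lt_add_one _)⟩

theorem IsLadder.finite_inter_Iio {δ γ : Ordinal.{u}} {X : Set Ordinal.{u}} (h : IsLadder δ X)
    (hγ : γ < δ) : (X ∩ Set.Iio γ).Finite := by
  obtain ⟨-, h2, ⟨f⟩⟩ := h
  obtain ⟨α, hα, hγα⟩ := h2 γ hγ
  refine ((Set.finite_Iio (f.symm ⟨α, hα⟩)).image fun n => (f n : Ordinal.{u})).subset ?_
  rintro x ⟨hx, hxγ⟩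
  refine ⟨f.symm ⟨x, hx⟩, ?_, by simp⟩
  rw [Set.mem_Iio, OrderIso.lt_iff_lt]
  exact Subtype.mk_lt_mk.2 (lt_trans (show x < γ from hxγ) hγα)

/-- `Cseq` is defined as a union over ladders of minimal index; injectivity of `ind` leaves exactly
one of them. -/
theorem isLadder_Cseq {ind : ZFSet.{u} → Ordinal.{u}} (hind : IsIndexing ind) {δ : Ordinal.{u}}
    (hδ : δ < ω₁) (hlim : Order.IsSuccLimit δ) : IsLadder δ (Cseq ind δ) := by
  obtain ⟨X, hX, hmin⟩ := (wellFounded_lt : WellFounded ((· < ·) : Ordinal.{u} → _ → Prop)).onFun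
    |>.has_min (r := Function.onFun (· < ·) fun X : Set Ordinal.{u} => ind (code X))
    {X | IsLadder δ X} (exists_isLadder hδ hlim)
  have hXmin : IsMinLadder ind δ X := ⟨hX, fun Y hY => not_lt.1 (hmin Y hY)⟩
  have : Cseq ind δ = X := by
    ext γ
    constructor
    · rintro (h | ⟨Y, hY, hγ⟩)
      · rw [h] at hlim
        exact absurd hlim (Order.not_isSuccLimit_add_one γ)
      · have heq : ind (code Y) = ind (code X) := (hY.2 X hX).antisymm (hXmin.2 Y hY.1)
        have := hind.1.injOn (code_mem_H hδ hY.1.1) (code_mem_H hδ hX.1) heq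
        have hsub : Set.Iio δ ⊆ Set.Iio ω₁ := Set.Iio_subset_Iio hδ.le
        rwa [← code_injOn (hY.1.1.trans hsub) (hX.1.trans hsub) this]
    · exact fun h => Or.inr ⟨X, hXmin, h⟩
  rwa [this]

theorem Cseq_add_one (ind : ZFSet.{u} → Ordinal.{u}) (γ : Ordinal.{u}) :
    Cseq ind (γ + 1) = {γ} := by
  ext α
  constructor
  · rintro (h | ⟨X, hX, -⟩)
    · exact (Order.succ_injective (by simpa only [Order.succ_eq_add_one] using h)).symm
    · obtain ⟨β, hβ, hγβ⟩ := hX.1.2.1 γ (lt_add_one γ)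
      exact absurd (Order.lt_add_one_iff.1 (hX.1.1 hβ)) (not_le.2 hγβ)
  · rintro rfl
    exact Or.inl rfl

/-- Each `C β` is a cofinal subset of `β` of order type at most `ω`. -/
def IsCSequence (C : Ordinal.{u} → Set Ordinal.{u}) : Prop :=
  ∀ β < ω₁, C β ⊆ Set.Iio β ∧ (∀ γ < β, ∃ α ∈ C β, γ ≤ α) ∧ ∀ γ < β, (C β ∩ Set.Iio γ).Finite

theorem isCSequence_Cseq {ind : ZFSet.{u} → Ordinal.{u}} (hind : IsIndexing ind) :
    IsCSequence (Cseq ind) := by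
  intro β hβ
  rcases Ordinal.zero_or_succ_or_isSuccLimit β with rfl | ⟨γ, rfl⟩ | hlim
  · refine ⟨?_, by simp, by simp⟩
    rintro γ (h | ⟨X, hX, hγ⟩)
    · exact absurd h (add_pos_of_right one_pos γ).ne
    · exact hX.1.1 hγ
  · rw [Order.succ_eq_add_one, Cseq_add_one]
    refine ⟨by simp, fun α hα => ⟨γ, rfl, Order.lt_add_one_iff.1 hα⟩, fun α _ => ?_⟩
    exact (Set.finite_singleton γ).subset Set.inter_subset_left
  · have h := isLadder_Cseq hind hβ hlim
    refine ⟨h.1, fun γ hγ => ?_, fun γ hγ => h.finite_inter_Iio hγ⟩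
    obtain ⟨α, hα, h⟩ := h.2.1 γ hγ
    exact ⟨α, hα, h.le⟩

/-- Every ordinal above some member of a ladder lies between consecutive members of it. -/
theorem IsLadder.exists_consecutive {δ γ ν : Ordinal.{u}} {X : Set Ordinal.{u}}
    (h : IsLadder δ X) (hγ : γ ∈ X) (hγν : γ < ν) (hν : ν < δ) :
    ∃ α ∈ X, ∃ β ∈ X, γ ≤ α ∧ α < ν ∧ ν ≤ β ∧ ∀ ξ ∈ X, ¬ (α < ξ ∧ ξ < β) := by
  obtain ⟨α, ⟨hα, hαν⟩, hmax⟩ :=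
    Set.exists_max_image _ id (h.finite_inter_Iio hν) ⟨γ, hγ, hγν⟩
  obtain ⟨β₀, hβ₀, hνβ₀⟩ := h.2.1 ν hν
  have hne : (X \ Set.Iio ν).Nonempty := ⟨β₀, hβ₀, not_lt.2 hνβ₀.le⟩
  obtain ⟨hβ, hβν⟩ := csInf_mem hne
  refine ⟨α, hα, sInf (X \ Set.Iio ν), hβ, hmax γ ⟨hγ, hγν⟩, hαν, not_lt.1 hβν, ?_⟩
  rintro ξ hξ ⟨h1, h2⟩
  rcases lt_or_ge ξ ν with h3 | h3
  · exact absurd (hmax ξ ⟨hξ, h3⟩) (not_le.2 h1)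
  · exact absurd (csInf_le' (s := X \ Set.Iio ν) ⟨hξ, not_lt.2 h3⟩) (not_le.2 h2)

/-! ### The maximal weight of walks -/

/-- If the weight is at most `k`, the first step of the walk from `β` goes to one of the finitely
many `γ ∈ C β` with at most `k` predecessors in `C β`. Then the walk either ends or continues from
`γ` with weight at most `k`, and induction applies. -/
theorem finite_rho1_le {C : Ordinal.{u} → Set Ordinal.{u}} (hC : IsCSequence C) (k : ℕ) :
    ∀ β < ω₁, {ξ | ξ < β ∧ rho1 C ξ β ≤ k}.Finite := by
  intro β
  induction β using WellFoundedLT.induction with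
  | ind β ih =>
    intro hβ
    obtain ⟨hsub, hcof, hfin⟩ := hC β hβ
    have hB : {γ | γ ∈ C β ∧ (C β ∩ Set.Iio γ).ncard ≤ k}.Finite := by
      refine Set.Finite.of_injOn (f := fun γ => (C β ∩ Set.Iio γ).ncard) (t := Set.Iic k)
        (fun γ hγ => hγ.2) ?_ (Set.finite_Iic k)
      have : StrictMonoOn (fun γ => (C β ∩ Set.Iio γ).ncard) (C β) := by
        intro γ hγ γ' hγ' hlt
        refine Set.ncard_lt_ncard ⟨?_, fun hcon => ?_⟩ (hfin γ' (hsub hγ'))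
        · exact Set.inter_subset_inter_right _ (Set.Iio_subset_Iio hlt.le)
        · exact lt_irrefl γ (hcon ⟨hγ, hlt⟩).2
      exact this.injOn.mono fun γ hγ => hγ.1
    refine (hB.biUnion fun γ hγ => (Set.finite_singleton γ).union
      (ih γ (hsub hγ.1) ((hsub hγ.1).trans hβ))).subset ?_
    rintro ξ ⟨hξ, hle⟩
    obtain ⟨α, hα, hξα⟩ := hcof ξ hξ
    have hne : (C β \ Set.Iio ξ).Nonempty := ⟨α, hα, not_lt.2 hξα⟩
    have hmem := csInf_mem hne
    rw [rho1, dif_pos ⟨hξ, hsub hmem.1⟩, max_le_iff] at hle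
    rw [Set.mem_iUnion₂]
    refine ⟨sInf (C β \ Set.Iio ξ), ⟨hmem.1, ?_⟩, ?_⟩
    · suffices C β ∩ Set.Iio (sInf (C β \ Set.Iio ξ)) = C β ∩ Set.Iio ξ from this ▸ hle.1
      ext η
      refine and_congr_right fun hη => ⟨fun h => ?_, fun h => ?_⟩
      · by_contra h'
        exact absurd (csInf_le' (s := C β \ Set.Iio ξ) ⟨hη, h'⟩) (not_le.2 h)
      · exact lt_of_lt_of_le (show η < ξ from h) (not_lt.1 hmem.2)
    · rcases (show ξ ≤ _ from not_lt.1 hmem.2).lt_or_eq with h | h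
      · exact Or.inr ⟨h, hle.2⟩
      · exact Or.inl h

theorem two_pow_mul_odd_inj {a b c d : ℕ} (h : 2 ^ a * (2 * b + 1) = 2 ^ c * (2 * d + 1)) :
    a = c ∧ b = d := by
  have key : ∀ {a b c d : ℕ}, 2 ^ a * (2 * b + 1) = 2 ^ c * (2 * d + 1) → c ≤ a := by
    intro a b c d h
    by_contra! hlt
    obtain ⟨k, rfl⟩ := Nat.exists_eq_add_of_lt hlt
    rw [add_assoc, pow_add, mul_assoc] at h
    have := Nat.eq_of_mul_eq_mul_left (by positivity) h
    rw [pow_succ, mul_comm (2 ^ k), mul_assoc] at this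
    omega
  have hac : a = c := (key h.symm).antisymm (key h)
  subst hac
  have := Nat.eq_of_mul_eq_mul_left (by positivity) h
  omega

/-- The value encodes the weight and the position among ordinals of the same weight; within one
weight the position strictly increases. -/
theorem rhoBar1_injOn {C : Ordinal.{u} → Set Ordinal.{u}} (hC : IsCSequence C) {β : Ordinal.{u}}
    (hβ : β < ω₁) : Set.InjOn (fun α => rhoBar1 C α β) (Set.Iio β) := by
  have key : ∀ α α', α < α' → α' < β → rhoBar1 C α β ≠ rhoBar1 C α' β := by
    intro α α' hlt hα' h
    obtain ⟨h1, h2⟩ := two_pow_mul_odd_inj h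
    refine absurd h2 (Set.ncard_lt_ncard ⟨fun ξ hξ => ?_, fun hcon => ?_⟩ ?_).ne
    · exact ⟨hξ.1.trans hlt.le, hξ.2.trans h1⟩
    · exact absurd (hcon ⟨le_rfl, rfl⟩).1 (not_le.2 hlt)
    -- Finiteness is essential: `ncard` of an infinite set is `0`.
    · exact (finite_rho1_le hC (rho1 C α' β) β hβ).subset fun ξ hξ =>
        ⟨lt_of_le_of_lt hξ.1 hα', hξ.2.le⟩
  intro α hα α' hα' h
  rcases lt_trichotomy α α' with hlt | heq | hlt
  · exact absurd h (key α α' hlt hα')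
  · exact heq
  · exact absurd h.symm (key α' α hlt hα)

/-! ### Truncations and almost disjointness in the tree -/

section Tilde

variable {ind : ZFSet.{u} → Ordinal.{u}} {star : Ordinal.{u} → Ordinal.{u}} {E : Set Ordinal.{u}}

/-- The elements of `T̃` with supremum less than `δ`. -/
def tildeBelow (ind : ZFSet.{u} → Ordinal.{u}) (star : Ordinal.{u} → Ordinal.{u})
    (E : Set Ordinal.{u}) (δ : Ordinal.{u}) : Set (Set Ordinal.{u}) :=
  {s | ∃ ξ, ∃ _hξ : ξ < δ, s ∈ tildeLevel ind star E ξ}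

theorem mem_tildeLevel_iff {δ : Ordinal.{u}} {t : Set Ordinal.{u}} :
    t ∈ tildeLevel ind star E δ ↔ t ∈ T ind E ∧ sSup t = δ ∧
      (t = ∅ ∨ (δ ∉ limPts t ∧ t ∩ Set.Iio δ ∈ tildeBelow ind star E δ) ∨
        (δ ∈ limPts t ∧ (∀ α < δ, t ∩ Set.Iic α ∈ tildeBelow ind star E δ) ∧
          {p ∈ consecPairs (Cseq ind δ) t | ¬ thetaAll ind star E (tildeBelow ind star E δ) δ p.2
            (t ∩ Set.Ioc p.1 p.2) (t ∩ Set.Iic p.1)}.Finite)) := by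
  rw [tildeLevel]
  rfl

theorem T_subset_Iio {t : Set Ordinal.{u}} (h : t ∈ T ind E) : t ⊆ Set.Iio ω₁ :=
  fun _ hx => (h.2.1 hx).1

theorem le_sSup_of_mem_T {t : Set Ordinal.{u}} (h : t ∈ T ind E) {x : Ordinal.{u}} (hx : x ∈ t) :
    x ≤ sSup t :=
  le_csSup ⟨ω₁, fun _ hy => (T_subset_Iio h hy).le⟩ hx

theorem Ttilde_subset_T : Ttilde ind star E ⊆ T ind E := by
  rintro t ⟨δ, h⟩
  exact (mem_tildeLevel_iff.1 h).1

theorem mem_tildeLevel_sSup {t : Set Ordinal.{u}} (h : t ∈ Ttilde ind star E) :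
    t ∈ tildeLevel ind star E (sSup t) := by
  obtain ⟨δ, h⟩ := h
  rwa [(mem_tildeLevel_iff.1 h).2.1]

theorem inter_Iic_mem_Ttilde {t : Set Ordinal.{u}} (h : t ∈ Ttilde ind star E) (ν : Ordinal.{u}) :
    t ∩ Set.Iic ν ∈ Ttilde ind star E := by
  obtain ⟨δ, h⟩ := h
  induction δ using WellFoundedLT.induction generalizing t with
  | ind δ ih =>
    obtain ⟨hT, hsup, h'⟩ := mem_tildeLevel_iff.1 h
    rcases le_or_gt δ ν with hle | hlt
    · have hsub : t ⊆ Set.Iic ν := fun x hx =>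
        ((le_sSup_of_mem_T hT hx).trans_eq hsup).trans hle
      rw [Set.inter_eq_left.2 hsub]
      exact ⟨δ, h⟩
    · rcases h' with rfl | ⟨-, ξ, hξ, h2⟩ | ⟨-, h2, -⟩
      · rw [Set.empty_inter]
        exact ⟨δ, h⟩
      · have : t ∩ Set.Iic ν = t ∩ Set.Iio δ ∩ Set.Iic ν := by
          rw [Set.inter_assoc, Set.inter_eq_right.2 (Set.Iic_subset_Iio.2 hlt)]
        rw [this]
        exact ih ξ hξ h2
      · obtain ⟨ξ, hξ, h3⟩ := h2 ν hlt
        exact ⟨ξ, h3⟩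

theorem limPts_inter_Iic {t : Set Ordinal.{u}} {δ : Ordinal.{u}} (h : δ ∈ limPts t) :
    δ ∈ limPts (t ∩ Set.Iic δ) := by
  refine ⟨h.1, h.2.1, fun γ hγ => ?_⟩
  obtain ⟨α, h1, h2, h3⟩ := h.2.2 γ hγ
  exact ⟨α, ⟨h1, h3.le⟩, h2, h3⟩

theorem isSuccLimit_of_mem_limPts {t : Set Ordinal.{u}} {δ : Ordinal.{u}} (h : δ ∈ limPts t) :
    Order.IsSuccLimit δ := by
  refine ⟨fun h0 => h.2.1 (isMin_iff_eq_bot.1 h0), fun γ hγ => ?_⟩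
  obtain ⟨α, -, h2, h3⟩ := h.2.2 γ hγ.lt
  exact hγ.2 h2 h3

/-- All but finitely many of the pieces of `t ∈ T̃` below a limit point satisfy the formulas. -/
theorem finite_not_thetaAll (hind : IsIndexing ind) {t : Set Ordinal.{u}}
    (h : t ∈ Ttilde ind star E) {δ : Ordinal.{u}} (hδ : δ ∈ limPts t) :
    {p ∈ consecPairs (Cseq ind δ) t | ¬ thetaAll ind star E (tildeBelow ind star E δ) δ p.2
      (t ∩ Set.Ioc p.1 p.2) (t ∩ Set.Iic p.1)}.Finite := by
  -- The truncation at `δ` has supremum `δ`, so it sits at level `δ`, where the clause for limit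
  -- points applies; its pieces between elements of `C_δ` are those of `t`.
  have hmem := inter_Iic_mem_Ttilde h δ
  have hδt : δ ∈ t := (Ttilde_subset_T h).2.2.1 hδ
  have hsup : sSup (t ∩ Set.Iic δ) = δ :=
    IsGreatest.csSup_eq ⟨⟨hδt, Set.self_mem_Iic⟩, fun x hx => hx.2⟩
  have hlev := mem_tildeLevel_sSup hmem
  rw [hsup] at hlev
  have hδ' := limPts_inter_Iic hδ
  rcases (mem_tildeLevel_iff.1 hlev).2.2 with h0 | h0 | h0
  · rw [h0] at hδ'
    obtain ⟨α, hα, -⟩ := hδ'.2.2 0 (pos_iff_ne_zero.2 hδ'.2.1)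
    exact absurd hα (Set.notMem_empty α)
  · exact absurd hδ' h0.1
  · have hlad := isLadder_Cseq hind hδ.1 (isSuccLimit_of_mem_limPts hδ)
    refine h0.2.2.subset ?_
    rintro ⟨α, β⟩ ⟨hp, hnot⟩
    have hα : α < δ := hlad.1 hp.1
    have hβ : β < δ := hlad.1 hp.2.1
    have h1 : t ∩ Set.Iic δ ∩ Set.Ioc α β = t ∩ Set.Ioc α β := by
      have hsub : Set.Ioc α β ⊆ Set.Iic δ := fun x hx => hx.2.trans hβ.le
      rw [Set.inter_assoc, Set.inter_eq_right.2 hsub]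
    have h2 : t ∩ Set.Iic δ ∩ Set.Iic α = t ∩ Set.Iic α := by
      rw [Set.inter_assoc, Set.inter_eq_right.2 (Set.Iic_subset_Iic.2 hα.le)]
    refine ⟨⟨hp.1, hp.2.1, hp.2.2.1, hp.2.2.2.1, ?_⟩, ?_⟩
    · rw [h1]
      exact hp.2.2.2.2
    · rw [h1, h2]
      exact hnot

/-- Pieces belonging to different initial parts are almost disjoint. -/
theorem subsingleton_inter_of_thetaAll (hind : IsIndexing ind) {S : Set (Set Ordinal.{u})}
    {δ β : Ordinal.{u}} (hδ : δ < ω₁) (hβ : β < δ) {x y s t : Set Ordinal.{u}}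
    (hx : thetaAll ind star E S δ β x s) (hy : thetaAll ind star E S δ β y t) (hst : s ≠ t) :
    (x ∩ y).Subsingleton := by
  have hx' := (thetaAll_iff ..).1 hx
  have hy' := (thetaAll_iff ..).1 hy
  have hmin : ∀ {x s}, Dom S x s β → sInf x < δ := fun h => (h.2.1 (csInf_mem h.1)).trans hβ
  -- For different values, `θ₂` for the piece with the larger value applies. Equal values give equal
  -- minima, and then `θ₀` forces `s = t`.
  rcases lt_trichotomy (e ind δ (sInf x)) (e ind δ (sInf y)) with h | h | h
  · refine Set.subsingleton_singleton.anti ?_ (t := {sInf y})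
    rw [Set.inter_comm]
    exact hy'.2.2.2.1 x s h hx
  · have heq := rhoBar1_injOn (isCSequence_Cseq hind) hδ (hmin hx'.1) (hmin hy'.1) h
    obtain ⟨-, -, m, hm⟩ := hx'.2.1
    obtain ⟨-, -, n, hn⟩ := hy'.2.1
    rw [starMin, heq] at hm
    rw [starMin] at hn
    exact absurd (indPair_inj hind (hβ.trans hδ) hx'.1.2.2.2.2 hy'.1.2.2.2.2 (hm.symm.trans hn)) hst
  · exact Set.subsingleton_singleton.anti (hx'.2.2.2.1 y t h hy)

theorem Ttilde_almost_disjoint (hind : IsIndexing ind) {s t : Set Ordinal.{u}}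
    (hs : s ∈ Ttilde ind star E) (ht : t ∈ Ttilde ind star E) {δ : Ordinal.{u}}
    (hδs : δ ∈ limPts s) (hδt : δ ∈ limPts t) (hne : s ∩ Set.Iio δ ≠ t ∩ Set.Iio δ) :
    ∃ γ < δ, ∀ ν ∈ limPts (s ∩ t), γ < ν → ¬ ν < δ := by
  have hlad := isLadder_Cseq hind hδs.1 (isSuccLimit_of_mem_limPts hδs)
  obtain ⟨η, hηδ, hη⟩ : ∃ η < δ, ¬ (η ∈ s ↔ η ∈ t) := by
    by_contra! hcon
    exact hne (Set.ext fun x => and_congr_left fun hx => hcon x hx)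
  -- The bound `γ` is taken in the ladder above the point `η` of difference and above the left ends
  -- of the finitely many exceptional pairs of either element.
  have hbad := (finite_not_thetaAll hind hs hδs).union (finite_not_thetaAll hind ht hδt)
  have hb : hbad.toFinset.sup Prod.fst ⊔ η < δ := by
    rw [max_lt_iff, Finset.sup_lt_iff (bot_le.trans_lt hηδ)]
    refine ⟨fun p hp => hlad.1 ?_, hηδ⟩
    rcases hbad.mem_toFinset.1 hp with h | h <;> exact h.1.1
  obtain ⟨γ, hγ, hbγ⟩ := hlad.2.1 _ hb
  refine ⟨γ, hlad.1 hγ, fun ν hν hγν hνδ => ?_⟩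
  obtain ⟨α, hα, β, hβ, hγα, hαν, hνβ, hcons⟩ := hlad.exists_consecutive hγ hγν hνδ
  -- A limit point `ν` of `s ∩ t` in `(α, β]` yields two common points of the pieces, one more than
  -- allowed.
  obtain ⟨x, hx, hαx, hxν⟩ := hν.2.2 α hαν
  obtain ⟨y, hy, hxy, hyν⟩ := hν.2.2 x hxν
  have hxm : x ∈ Set.Ioc α β := ⟨hαx, hxν.le.trans hνβ⟩
  have hym : y ∈ Set.Ioc α β := ⟨hαx.trans hxy, hyν.le.trans hνβ⟩
  have hαb : hbad.toFinset.sup Prod.fst ⊔ η < α := hbγ.trans_le hγα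
  have hnb : (α, β) ∉ hbad.toFinset := fun h =>
    absurd ((Finset.le_sup (f := Prod.fst) h).trans le_sup_left) (not_le.2 hαb)
  rw [hbad.mem_toFinset, Set.mem_union, not_or] at hnb
  have hθ : ∀ {r : Set Ordinal.{u}}, x ∈ r → (α, β) ∉ {p ∈ consecPairs (Cseq ind δ) r |
      ¬ thetaAll ind star E (tildeBelow ind star E δ) δ p.2
        (r ∩ Set.Ioc p.1 p.2) (r ∩ Set.Iic p.1)} →
      thetaAll ind star E (tildeBelow ind star E δ) δ β (r ∩ Set.Ioc α β) (r ∩ Set.Iic α) :=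
    fun hxr hn => by
      by_contra hcon
      exact hn ⟨⟨hα, hβ, hαν.trans_le hνβ, hcons, x, hxr, hxm⟩, hcon⟩
  have hηα : η ≤ α := (le_sup_right.trans_lt hαb).le
  refine hxy.ne (subsingleton_inter_of_thetaAll hind hδs.1 (hlad.1 hβ) (hθ hx.1 hnb.1)
    (hθ hx.2 hnb.2) (fun h => hη ?_) ⟨⟨hx.1, hxm⟩, hx.2, hxm⟩ ⟨⟨hy.1, hym⟩, hy.2, hym⟩)
  have := Set.ext_iff.1 h η
  simpa [hηα] using this

/-- If for some unbounded `C ⊆ ω₁` all sets `C ∩ δ` are covered by `n` elements of `T̃`, then `T̃`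
has an uncountable chain. -/
theorem Ttilde_exists_uncountable_chain (hind : IsIndexing ind) {n : ℕ} {C : Set Ordinal.{u}}
    (hC : IsUnbounded C) (h : ∀ δ < ω₁, CoveredBy (Ttilde ind star E) n (C ∩ Set.Iio δ)) :
    ∃ b ⊆ Ttilde ind star E, IsChain InitialPart b ∧ ¬ b.Countable :=
  exists_uncountable_chain (fun _ ht => (Ttilde_subset_T ht).2.2.1)
    (fun _ hs _ ht _ hδs hδt hne => Ttilde_almost_disjoint hind hs ht hδs hδt hne)
    (fun _ ht δ _ => inter_Iic_mem_Ttilde ht δ) hC h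

end Tilde

/-! ### Formulas of set theory with named variables -/

section Formulas

open FirstOrder Language

variable {α : Type*}

/-- The symbol for the membership relation. -/
def memSym : langSet.Relations 2 := SetRel.mem

/-- The formula `x_i ∈ x_j`. -/
def fMem (i j : α) : langSet.Formula α :=
  memSym.formula₂ (Term.var i) (Term.var j)

/-- The formula `x_i = x_j`. -/
def fEq (i j : α) : langSet.Formula α :=
  Term.equal (Term.var i) (Term.var j)

@[simp]
theorem realize_fMem {A : Set ZFSet.{u}} {i j : α} {v : α → A} :
    (fMem i j).Realize v ↔ (v i : ZFSet.{u}) ∈ (v j : ZFSet.{u}) :=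
  Formula.realize_rel₂.trans Iff.rfl

@[simp]
theorem realize_fEq {N : Type*} [langSet.Structure N] {i j : α} {v : α → N} :
    (fEq i j).Realize v ↔ v i = v j :=
  Formula.realize_equal.trans Iff.rfl

variable [DecidableEq α]

/-- The formula `∃ x_k, φ`. -/
noncomputable def fEx (k : α) (φ : langSet.Formula α) : langSet.Formula α :=
  Formula.iExs Unit (φ.relabel fun i => if i = k then Sum.inr () else Sum.inl i)

/-- The formula `∀ x_k, φ`. -/
noncomputable def fAll (k : α) (φ : langSet.Formula α) : langSet.Formula α :=
  ∼(fEx k ∼φ)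

@[simp]
theorem realize_fEx {N : Type*} [langSet.Structure N] {k : α} {φ : langSet.Formula α}
    {v : α → N} : (fEx k φ).Realize v ↔ ∃ x, φ.Realize (Function.update v k x) := by
  have key : ∀ w : Unit → N, (Sum.elim v w ∘ fun i => if i = k then Sum.inr () else Sum.inl i) =
      Function.update v k (w ()) := by
    intro w
    ext i
    by_cases h : i = k
    · subst h; simp
    · simp [h]
  rw [fEx, Formula.realize_iExs]
  simp only [Formula.realize_relabel, key]
  exact ⟨fun ⟨w, hw⟩ => ⟨w (), hw⟩, fun ⟨x, hx⟩ => ⟨fun _ => x, hx⟩⟩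

@[simp]
theorem realize_fAll {N : Type*} [langSet.Structure N] {k : α} {φ : langSet.Formula α}
    {v : α → N} : (fAll k φ).Realize v ↔ ∀ x, φ.Realize (Function.update v k x) := by
  simp [fAll, Formula.realize_not, realize_fEx]

/-- The formula saying that `x_2 ∈ x_1` and that `x_1 ∩ x_2` is not covered by `n` elements
of `x_0`. -/
noncomputable def fUncovered (n : ℕ) : langSet.Formula ℕ :=
  fMem 2 1 ⊓ Formula.iAlls (Fin n)
    ((Formula.iInf fun i : Fin n => fMem (Sum.inr i) (Sum.inl 0)) ⟹
      fEx (Sum.inl 3) (fMem (Sum.inl 3) (Sum.inl 1) ⊓ fMem (Sum.inl 3) (Sum.inl 2) ⊓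
        Formula.iInf fun i : Fin n => ∼(fMem (Sum.inl 3) (Sum.inr i))))

theorem realize_fUncovered {A : Set ZFSet.{u}} {n : ℕ} {v : ℕ → A} :
    (fUncovered n).Realize v ↔ (v 2 : ZFSet.{u}) ∈ (v 1 : ZFSet.{u}) ∧
      ∀ t : Fin n → A, (∀ i, (t i : ZFSet.{u}) ∈ (v 0 : ZFSet.{u})) →
        ∃ c : A, ((c : ZFSet.{u}) ∈ (v 1 : ZFSet.{u}) ∧ (c : ZFSet.{u}) ∈ (v 2 : ZFSet.{u})) ∧
          ∀ i, (c : ZFSet.{u}) ∉ (t i : ZFSet.{u}) := by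
  simp only [fUncovered, Formula.realize_inf, realize_fMem, Formula.realize_iAlls,
    Formula.realize_imp, Formula.realize_iInf, realize_fEx, Formula.realize_not,
    Function.update_self, Sum.elim_inl, Sum.elim_inr, ne_eq, reduceCtorEq, not_false_eq_true,
    Function.update_of_ne, Sum.inl.injEq, OfNat.one_ne_ofNat, Nat.reduceEqDiff]

/-- A set definable from parameters in an elementary substructure meets the substructure if it is
nonempty. -/
theorem exists_mem_of_realize {N : Type*} [langSet.Structure N]
    (S : langSet.ElementarySubstructure N) (φ : langSet.Formula α) (k : α) {v : α → N}
    (hv : ∀ i, v i ∈ S) (h : ∃ x, φ.Realize (Function.update v k x)) :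
    ∃ x ∈ S, φ.Realize (Function.update v k x) := by
  let w : α → S := fun i => ⟨v i, hv i⟩
  have hw : ∀ (y : S), S.subtype ∘ Function.update w k y = Function.update v k y := by
    intro y
    rw [Function.comp_update]
    rfl
  have h1 : (fEx k φ).Realize (S.subtype ∘ w) := realize_fEx.2 h
  rw [S.subtype.map_formula] at h1
  obtain ⟨y, hy⟩ := realize_fEx.1 h1
  rw [← S.subtype.map_formula, hw] at hy
  exact ⟨y, y.2, hy⟩

end Formulas

/-! ### Reflection to an elementary submodel -/

section Submodel

open FirstOrder Language

variable {θ : Cardinal.{u}} (S : langSet.ElementarySubstructure (H θ))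

/-- If a set `X` of ordinals belongs to an elementary submodel and every member of it is the least
one or the immediate successor of another one, then it is included in the submodel. -/
theorem mem_of_immediate_succ {X : H θ} (hX : X ∈ S)
    (hord : ∀ y ∈ (X : ZFSet.{u}), ∃ α : Ordinal.{u}, α.toZFSet = y)
    (hsucc : ∀ y ∈ (X : ZFSet.{u}), (∀ z ∈ (X : ZFSet.{u}), z ∉ y) ∨
      ∃ m ∈ (X : ZFSet.{u}), m ∈ y ∧ ∀ z ∈ (X : ZFSet.{u}), ¬ (m ∈ z ∧ z ∈ y))
    (y : H θ) (hy : (y : ZFSet.{u}) ∈ (X : ZFSet.{u})) : y ∈ S := by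
  have htri : ∀ a ∈ (X : ZFSet.{u}), ∀ b ∈ (X : ZFSet.{u}), a ∈ b ∨ a = b ∨ b ∈ a := by
    intro a ha b hb
    obtain ⟨α, rfl⟩ := hord a ha
    obtain ⟨β, rfl⟩ := hord b hb
    rw [Ordinal.toZFSet_mem_toZFSet_iff, Ordinal.toZFSet_mem_toZFSet_iff,
      Ordinal.toZFSet_injective.eq_iff]
    exact lt_trichotomy α β
  obtain ⟨y, hyH⟩ := y
  -- By `∈`-induction: the least member is definable from `X`, any other one from `X` and its
  -- immediate predecessor.
  induction y using ZFSet.inductionOn with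
  | _ y ih =>
    rcases hsucc y hy with h | ⟨m, hm, hmy, h⟩
    · obtain ⟨x, hx, hφ⟩ := exists_mem_of_realize S
        (fMem 1 0 ⊓ fAll 2 (fMem 2 0 ⟹ ∼(fMem 2 1)) : langSet.Formula ℕ) 1
        (v := fun _ => X) (fun _ => hX) ⟨⟨y, hyH⟩, by
          simpa using ⟨hy, fun z _ hz => h z hz⟩⟩
      simp at hφ
      have hxy : x = ⟨y, hyH⟩ := by
        rcases htri x hφ.1 y hy with h1 | h1 | h1
        · exact absurd h1 (h x hφ.1)
        · exact Subtype.ext h1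
        · exact absurd h1 (hφ.2 y hyH hy)
      rwa [← hxy]
    · have hmS := ih m hmy (mem_H_of_mem hyH hmy) hm
      obtain ⟨x, hx, hφ⟩ := exists_mem_of_realize S
        (fMem 1 0 ⊓ fMem 2 1 ⊓ fAll 3 (fMem 3 0 ⟹ ∼(fMem 2 3 ⊓ fMem 3 1)) : langSet.Formula ℕ) 1
        (v := Function.update (fun _ => X) 2 ⟨m, mem_H_of_mem hyH hmy⟩) (fun i => by
          by_cases hi : i = 2
          · subst hi
            simpa using hmS
          · simpa [hi] using hX) ⟨⟨y, hyH⟩, by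
          simpa using ⟨⟨hy, hmy⟩, fun a _ ha h1 h2 => h a ha ⟨h1, h2⟩⟩⟩
      simp at hφ
      have hxy : x = ⟨y, hyH⟩ := by
        rcases htri x hφ.1.1 y hy with h1 | h1 | h1
        · exact absurd ⟨hφ.1.2, h1⟩ (h x hφ.1.1)
        · exact Subtype.ext h1
        · exact absurd h1 (hφ.2 y hyH hy hmy)
      rwa [← hxy]

/-- The countable ordinals in an elementary submodel of `H(θ)` form an initial segment. -/
theorem toZFSet_mem_of_lt {ind : ZFSet.{u} → Ordinal.{u}} (hind : IsIndexing ind) (hθ : ℵ₁ ≤ θ)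
    {δ c : Ordinal.{u}} (hδ : δ < ω₁) (hδS : δ.toZFSet ∈ Subtype.val '' (S : Set (H θ)))
    (hc : c < δ) : c.toZFSet ∈ Subtype.val '' (S : Set (H θ)) := by
  induction δ using WellFoundedLT.induction with
  | ind δ ih =>
    obtain ⟨d, hdS, hd⟩ := hδS
    obtain ⟨hsub, hcof, hfin⟩ := isCSequence_Cseq hind δ hδ
    have hmemd : ∀ {z : ZFSet.{u}}, z ∈ (d : ZFSet.{u}) → ∃ α < δ, α.toZFSet = z := by
      intro z hz
      rwa [hd, Ordinal.mem_toZFSet_iff] at hz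
    have hmemX : ∀ {z : ZFSet.{u}}, z ∈ code (Cseq ind δ) → ∃ α ∈ Cseq ind δ, α.toZFSet = z := by
      intro z hz
      obtain ⟨α, h1, -, h2⟩ := mem_code.1 hz
      exact ⟨α, h1, h2⟩
    have hmemX' : ∀ α ∈ Cseq ind δ, α.toZFSet ∈ code (Cseq ind δ) := fun α hα =>
      toZFSet_mem_code.2 ⟨hα, lt_trans (hsub hα) hδ⟩
    have hXH : code (Cseq ind δ) ∈ H θ := H_mono hθ (code_mem_H hδ hsub)
    -- The formula says that `X ⊆ δ` is cofinal and that each member is least or an immediate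
    -- successor in `X`. `C_δ` witnesses it, and it mentions neither `ω` nor functions. The `X`
    -- found in `S` need not be `C_δ`, but all its members lie in `S`.
    obtain ⟨X, hXS, hφ⟩ := exists_mem_of_realize S
      (fAll 2 (fMem 2 1 ⟹ fMem 2 0) ⊓
        fAll 2 (fMem 2 0 ⟹ fEx 3 (fMem 3 1 ⊓ (fMem 2 3 ⊔ fEq 2 3))) ⊓
        fAll 2 (fMem 2 1 ⟹ (fAll 3 (fMem 3 1 ⟹ ∼(fMem 3 2)) ⊔
          fEx 4 (fMem 4 1 ⊓ fMem 4 2 ⊓ fAll 3 (fMem 3 1 ⟹ ∼(fMem 4 3 ⊓ fMem 3 2))))) :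
        langSet.Formula ℕ) 1
      (v := fun _ => d) (fun _ => hdS) ⟨⟨code (Cseq ind δ), hXH⟩, by
        simp
        refine ⟨⟨?_, ?_⟩, ?_⟩
        · intro z _ hz
          obtain ⟨α, hα, rfl⟩ := hmemX hz
          rw [hd]
          exact Ordinal.toZFSet_mem_toZFSet_iff.2 (hsub hα)
        · intro z _ hz
          obtain ⟨γ, hγ, rfl⟩ := hmemd hz
          obtain ⟨α, hα, hle⟩ := hcof γ hγ
          refine ⟨α.toZFSet, hmemX' α hα, mem_H_of_mem hXH (hmemX' α hα), ?_⟩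
          rw [Ordinal.toZFSet_mem_toZFSet_iff, Ordinal.toZFSet_injective.eq_iff]
          exact hle.lt_or_eq
        · intro z _ hz
          obtain ⟨γ, hγ, rfl⟩ := hmemX hz
          rcases (Cseq ind δ ∩ Set.Iio γ).eq_empty_or_nonempty with h | h
          · left
            intro y _ hy hyγ
            obtain ⟨α, hα, rfl⟩ := hmemX hy
            rw [Ordinal.toZFSet_mem_toZFSet_iff] at hyγ
            exact Set.eq_empty_iff_forall_notMem.1 h α ⟨hα, hyγ⟩
          · right
            obtain ⟨m, ⟨hm, hmγ⟩, hmax⟩ := Set.exists_max_image _ id (hfin γ (hsub hγ)) h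
            refine ⟨m.toZFSet, ⟨hmemX' m hm, Ordinal.toZFSet_mem_toZFSet_iff.2 hmγ⟩,
              mem_H_of_mem hXH (hmemX' m hm), ?_⟩
            intro y _ hy
            obtain ⟨α, hα, rfl⟩ := hmemX hy
            rw [Ordinal.toZFSet_mem_toZFSet_iff, Ordinal.toZFSet_mem_toZFSet_iff]
            exact fun h1 h2 => absurd (hmax α ⟨hα, h2⟩) (not_le.2 h1)⟩
    simp at hφ
    obtain ⟨⟨h1, h2⟩, h3⟩ := hφ
    have hXH' : ∀ {z}, z ∈ (X : ZFSet.{u}) → z ∈ H θ := fun h => mem_H_of_mem X.2 h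
    have hcd : c.toZFSet ∈ (d : ZFSet.{u}) := hd ▸ Ordinal.toZFSet_mem_toZFSet_iff.2 hc
    obtain ⟨z, hzX, hzH, hcz⟩ := h2 c.toZFSet (mem_H_of_mem d.2 hcd) hcd
    obtain ⟨ζ, hζ, rfl⟩ := hmemd (h1 z hzH hzX)
    have hζS : ζ.toZFSet ∈ Subtype.val '' (S : Set (H θ)) := by
      refine ⟨⟨ζ.toZFSet, hzH⟩, mem_of_immediate_succ S hXS ?_ ?_ _ hzX, rfl⟩
      · intro y hy
        obtain ⟨α, -, hα⟩ := hmemd (h1 y (hXH' hy) hy)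
        exact ⟨α, hα⟩
      · intro y hy
        rcases h3 y (hXH' hy) hy with h | ⟨m, ⟨hm, hmy⟩, -, h⟩
        · exact Or.inl fun z hz => h z (hXH' hz) hz
        · exact Or.inr ⟨m, hm, hmy, fun z hz hh => h z (hXH' hz) hz hh.1 hh.2⟩
    rw [Ordinal.toZFSet_mem_toZFSet_iff, Ordinal.toZFSet_injective.eq_iff] at hcz
    rcases hcz with hcz | rfl
    · exact ih ζ hζ (hζ.trans hδ) hζS hcz
    · exact hζS

theorem mem_codeFam {D : Set (Set Ordinal.{u})} {z : ZFSet.{u}} :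
    z ∈ codeFam D ↔ ∃ t ∈ D, code t = z := by
  rw [codeFam, ZFSet.mem_sep, and_iff_right_of_imp]
  rintro ⟨t, -, rfl⟩
  rw [ZFSet.mem_powerset]
  exact fun z hz => (ZFSet.mem_sep.1 hz).1

theorem exists_subset_Iio_of_countable {t : Set Ordinal.{u}} (ht : t.Countable)
    (h : t ⊆ Set.Iio ω₁) : ∃ β < ω₁, t ⊆ Set.Iio β := by
  have : Countable t := ht.to_subtype
  refine ⟨(⨆ x : t, (x : Ordinal.{u})) + 1,
    add_one_lt_omega_one (Ordinal.iSup_lt_omega_one fun x => h x.2), fun x hx => ?_⟩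
  exact Order.lt_add_one_iff.2 (Ordinal.le_iSup (fun x : t => (x : Ordinal.{u})) ⟨x, hx⟩)

/-- If `C` and a family `P` of countable sets belong to an elementary submodel of `H(θ)` and the
members of `C` in the submodel are covered by `n` members of `P`, then all `C ∩ δ` are. -/
theorem coveredBy_of_submodel {ind : ZFSet.{u} → Ordinal.{u}} (hind : IsIndexing ind)
    (hθ : ℵ₁ ≤ θ) {P : Set (Set Ordinal.{u})} (hP : ∀ t ∈ P, t.Countable ∧ t ⊆ Set.Iio ω₁)
    (hPS : codeFam P ∈ Subtype.val '' (S : Set (H θ))) {C : Set Ordinal.{u}} (hC : IsUnbounded C)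
    (hCS : code C ∈ Subtype.val '' (S : Set (H θ))) {n : ℕ} {t : Fin n → Set Ordinal.{u}}
    (ht : ∀ i, t i ∈ P)
    (hcover : ∀ α ∈ C, α.toZFSet ∈ Subtype.val '' (S : Set (H θ)) → ∃ i, α ∈ t i) :
    ∀ δ < ω₁, CoveredBy P n (C ∩ Set.Iio δ) := by
  classical
  by_contra! hcon
  obtain ⟨δ₀, hδ₀, hcon⟩ := hcon
  -- The formula to be reflected asks for an element of `C`; raising `δ₀` to one preserves
  -- uncoveredness.
  obtain ⟨δ, hδ, hlt⟩ := hC.2 δ₀ hδ₀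
  have hδω : δ < ω₁ := hC.1 hδ
  have hcode : ∀ {α}, α ∈ C → α.toZFSet ∈ code C := fun hα => toZFSet_mem_code.2 ⟨hα, hC.1 hα⟩
  obtain ⟨p, hpS, hp⟩ := hPS
  obtain ⟨d, hdS, hd⟩ := hCS
  have hdH : ∀ {α}, α ∈ C → α.toZFSet ∈ H θ := fun hα => mem_H_of_mem d.2 (hd ▸ hcode hα)
  have hmemd : ∀ {z}, z ∈ (d : ZFSet.{u}) → ∃ α ∈ C, α.toZFSet = z := by
    intro z hz
    rw [hd] at hz
    obtain ⟨α, h1, -, h2⟩ := mem_code.1 hz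
    exact ⟨α, h1, h2⟩
  obtain ⟨x, hxS, hφ⟩ := exists_mem_of_realize S (fUncovered n) 2
    (v := Function.update (fun _ => d) 0 p) (fun i => by
      by_cases hi : i = 0
      · subst hi
        simpa using hpS
      · simpa [hi] using hdS) ⟨⟨δ.toZFSet, hdH hδ⟩, by
      simp only [realize_fUncovered, ne_eq, not_false_eq_true, Function.update_self,
        Function.update_of_ne, OfNat.zero_ne_ofNat, OfNat.one_ne_ofNat,
        one_ne_zero]
      refine ⟨hd ▸ hcode hδ, fun s hs => ?_⟩
      have hs' : ∀ i, ∃ r ∈ P, code r = s i := fun i => mem_codeFam.1 (hp ▸ hs i)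
      choose r hr hrs using hs'
      by_contra! hno
      refine hcon ⟨Finset.univ.image r, ?_, Finset.card_image_le.trans_eq (by simp), ?_⟩
      · intro q hq
        obtain ⟨i, -, rfl⟩ := Finset.mem_image.1 hq
        exact hr i
      · rintro α ⟨hα, hαδ⟩
        obtain ⟨i, hi⟩ := hno ⟨α.toZFSet, hdH hα⟩ ⟨hd ▸ hcode hα,
          Ordinal.toZFSet_mem_toZFSet_iff.2 (lt_trans hαδ hlt)⟩
        rw [← hrs, toZFSet_mem_code] at hi
        exact ⟨r i, Finset.mem_image_of_mem r (Finset.mem_univ i), hi.1⟩⟩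
  simp only [realize_fUncovered, ne_eq, not_false_eq_true, Function.update_self,
    Function.update_of_ne, OfNat.zero_ne_ofNat, OfNat.one_ne_ofNat,
    one_ne_zero] at hφ
  obtain ⟨η, hη, hηx⟩ := hmemd hφ.1
  have htH : ∀ i, code (t i) ∈ H θ := fun i => by
    obtain ⟨β, hβ, hsub⟩ := exists_subset_Iio_of_countable (hP _ (ht i)).1 (hP _ (ht i)).2
    exact H_mono hθ (code_mem_H hβ hsub)
  -- The formula holds in the whole of `H θ`, so it may be applied to the `t i`, which need not
  -- belong to `S`. The missed point `c` is below `η ∈ S` and hence in `S`.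
  obtain ⟨c, ⟨hcd, hcx⟩, hct⟩ := hφ.2 (fun i => ⟨code (t i), htH i⟩)
    fun i => hp ▸ mem_codeFam.2 ⟨t i, ht i, rfl⟩
  obtain ⟨γ, hγ, hγc⟩ := hmemd hcd
  rw [← hγc, ← hηx, Ordinal.toZFSet_mem_toZFSet_iff] at hcx
  obtain ⟨i, hi⟩ := hcover γ hγ
    (toZFSet_mem_of_lt S hind hθ (hC.1 hη) ⟨x, hxS, hηx.symm⟩ hcx)
  exact hct i (hγc ▸ toZFSet_mem_code.2 ⟨hi, hC.1 hγ⟩)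

end Submodel

/-! ### The lemma -/

theorem IsClubOmega1.isUnbounded {C : Set Ordinal.{u}} (hC : IsClubOmega1 C) :
    IsUnbounded C := by
  refine ⟨hC.1, fun γ hγ => ?_⟩
  obtain ⟨⟨α, hα⟩, hαC, hle⟩ := hC.2.isCofinal ⟨γ + 1, add_one_lt_omega_one hγ⟩
  exact ⟨α, hαC, Order.add_one_le_iff.1 hle⟩

end SquareSpecialTree

open SquareSpecialTree in
theorem mainTheorem5 (hCH : (Cardinal.continuum : Cardinal.{u}) = ℵ₁)
    (ind : ZFSet.{u} → Ordinal.{u}) (hind : SquareSpecialTree.IsIndexing ind)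
    (star : Ordinal.{u} → Ordinal.{u}) (hstar : SquareSpecialTree.IsStar star)
    (E : Set Ordinal.{u}) (hE : SquareSpecialTree.IsClubOmega1 E)
    (M : Set ZFSet.{u})
    (hM : SquareSpecialTree.IsCountableElementarySubmodel M
      (Order.succ ((2 : Cardinal.{u}) ^ (ℵ₁ : Cardinal.{u}))))
    (hTM : SquareSpecialTree.codeFam (SquareSpecialTree.Ttilde ind star E) ∈ M)
    (n : ℕ) (t : Fin n → Set Ordinal.{u})
    (ht : ∀ i, t i ∈ SquareSpecialTree.Ttilde ind star E)
    (C : Set Ordinal.{u}) (hC : SquareSpecialTree.IsClubOmega1 C)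
    (hCM : SquareSpecialTree.code C ∈ M)
    (hcover : ∀ α ∈ C, α.toZFSet ∈ M → ∃ i, α ∈ t i) :
    ∃ b : Set (Set Ordinal.{u}), b ⊆ SquareSpecialTree.Ttilde ind star E ∧
      IsChain SquareSpecialTree.InitialPart b ∧ ¬ b.Countable := by
  obtain ⟨-, S, rfl⟩ := hM
  have hθ : (ℵ₁ : Cardinal.{u}) ≤ Order.succ (2 ^ (ℵ₁ : Cardinal.{u})) :=
    (Cardinal.cantor _).le.trans (Order.le_succ _)
  have hcov := coveredBy_of_submodel S hind hθ
    (fun s hs => ⟨(Ttilde_subset_T hs).1, T_subset_Iio (Ttilde_subset_T hs)⟩) hTM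
    hC.isUnbounded hCM ht hcover
  exact Ttilde_exists_uncountable_chain hind hC.isUnbounded hcov
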